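/- Let $\mathscr P$ be the space of Borel probability measures on $[0,1]$. For an integer $k$ and a real $\alpha\ge 0$ define a map $\mathbf R=\mathbf R^{\alpha}:\mathscr P\to\mathscr P$ as follows. Let $d^+,d^-$ be independent $\mathrm{Pois}(\alpha k/2)$ random variables and, given $\mu\in\mathscr P$, let $\vec\eta=(\eta^+_{ij},\eta^-_{ij})_{i,j\ge1}$ be an array of i.i.d. samples from $\mu$, independent of $(d^+,d^-)$. Then $\mathbf R\mu$ is the law of \[ R=\frac{(1-\Pi^-)\,\Pi^+}{\Pi^++\Pi^--\Pi^+\Pi^-},\qquad \Pi^{\pm}=\prod_{i=1}^{d^{\pm}}\Big(1-\prod_{j=1}^{k-1}\eta^{\pm}_{ij}\Big), \] with the convention $R=0$ if $\Pi^+=\Pi^-=0$. Let $\mu_0=\delta_{1/2}$ and $\mu_\ell=\mathbf R\mu_{\ell-1}$ for $\ell\ge1$. There is an absolute constant $k_0$ such that for every integer $k\ge k_0$ and every real $\alpha$ with $2^k\log 2-2\le\alpha\le 2^k\log 2$, the sequence $(\mu_\ell)_{\ell\ge0}$ converges weakly as $\ell\to\infty$ to a limit $\mu=\mu_\alpha\in\mathscr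 P$ satisfying $\mathbf R\mu=\mu$. Moreover $\mu(\{1\})=0$ and $\mu_\ell(\{1\})=0$ for all $\ell\ge 0$, so that the case $\Pi^+=\Pi^-=0$ almost surely does not occur when $\mathbf R$ is applied to any of these measures. -/

import Mathlib

open MeasureTheory ProbabilityTheory Filter Topology
open scoped NNReal unitInterval

noncomputable section

namespace KSat

/-- The array `(η⁺ᵢⱼ, η⁻ᵢⱼ)` of `[0,1]`-valued entries. The sign `true` stands for `+`, the sign
`false` for `-`; the indices `i, j` start at `0`. -/
abbrev EtaArray : Type := Bool × ℕ × ℕ → I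

/-- The sample space of `((d⁺, d⁻), η)`. -/
abbrev Sample : Type := (ℕ × ℕ) × EtaArray

/-- `∏_{i < d} (1 - ∏_{j < k-1} η^s_{ij})`. -/
def clauseProd (k : ℕ) (s : Bool) (d : ℕ) (η : EtaArray) : ℝ :=
  ∏ i ∈ Finset.range d, (1 - ∏ j ∈ Finset.range (k - 1), (η (s, i, j) : ℝ))

/-- `Π⁺(d, η)`. -/
def piPlus (k : ℕ) (ω : Sample) : ℝ := clauseProd k true ω.1.1 ω.2

/-- `Π⁻(d, η)`. -/
def piMinus (k : ℕ) (ω : Sample) : ℝ := clauseProd k false ω.1.2 ω.2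

/-- `R(d, η) = (1 - Π⁻) Π⁺ / (Π⁺ + Π⁻ - Π⁺ Π⁻)` as a real number (and `0` if `Π⁺ = Π⁻ = 0`). -/
def recReal (k : ℕ) (ω : Sample) : ℝ :=
  (1 - piMinus k ω) * piPlus k ω / (piPlus k ω + piMinus k ω - piPlus k ω * piMinus k ω)

theorem clauseProd_mem (k : ℕ) (s : Bool) (d : ℕ) (η : EtaArray) : clauseProd k s d η ∈ I := by
  have h : ∀ i : ℕ, (1 - ∏ j ∈ Finset.range (k - 1), (η (s, i, j) : ℝ)) ∈ I := fun i =>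
    ⟨sub_nonneg.2 (Finset.prod_le_one (fun j _ => (η (s, i, j)).2.1) fun j _ => (η (s, i, j)).2.2),
      sub_le_self _ (Finset.prod_nonneg fun j _ => (η (s, i, j)).2.1)⟩
  exact ⟨Finset.prod_nonneg fun i _ => (h i).1,
    Finset.prod_le_one (fun i _ => (h i).1) fun i _ => (h i).2⟩

theorem recReal_mem (k : ℕ) (ω : Sample) : recReal k ω ∈ I := by
  obtain ⟨hp0, hp1⟩ : piPlus k ω ∈ I := clauseProd_mem k true ω.1.1 ω.2
  obtain ⟨hm0, hm1⟩ : piMinus k ω ∈ I := clauseProd_mem k false ω.1.2 ω.2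
  have hn : 0 ≤ (1 - piMinus k ω) * piPlus k ω := mul_nonneg (by linarith) hp0
  have hle : (1 - piMinus k ω) * piPlus k ω ≤
      piPlus k ω + piMinus k ω - piPlus k ω * piMinus k ω := by nlinarith
  exact ⟨div_nonneg hn (hn.trans hle), div_le_one_of_le₀ hle (hn.trans hle)⟩

/-- `R(d, η)` as an element of `[0,1]`. -/
def recMap (k : ℕ) (ω : Sample) : I := ⟨recReal k ω, recReal_mem k ω⟩

theorem measurable_clauseProd (k : ℕ) (s : Bool) (d : ℕ) : Measurable (clauseProd k s d) := by
  unfold clauseProd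
  fun_prop

theorem measurable_recMap (k : ℕ) : Measurable (recMap k) := by
  refine Measurable.subtype_mk ?_
  refine measurable_from_prod_countable_right fun d => ?_
  have hp := measurable_clauseProd k true d.1
  have hm := measurable_clauseProd k false d.2
  exact ((measurable_const.sub hm).mul hp).div ((hp.add hm).sub (hp.mul hm))

/-- The joint law of `((d⁺, d⁻), η)`: `d⁺` and `d⁻` are Poisson with mean `α k / 2`, the entries of
`η` have law `μ`, and all these variables are independent. -/
def sampleLaw (k : ℕ) (α : ℝ≥0) (μ : ProbabilityMeasure I) : ProbabilityMeasure Sample :=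
  ⟨((poissonMeasure (α * k / 2)).prod (poissonMeasure (α * k / 2))).prod
      (Measure.infinitePi fun _ : Bool × ℕ × ℕ => (μ : Measure I)),
    inferInstance⟩

/-- The distributional recursion: the image of `μ` is the law of `R(d, η)`. -/
def distRec (k : ℕ) (α : ℝ≥0) (μ : ProbabilityMeasure I) : ProbabilityMeasure I :=
  (sampleLaw k α μ).map (measurable_recMap k).aemeasurable

/-- The point `1/2` of `[0,1]`. -/
def oneHalf : I := ⟨1 / 2, by norm_num, by norm_num⟩

/-- The iterates `μ_0 = δ_{1/2}`, `μ_{ℓ+1} = R^α μ_ℓ`. -/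
def iter (k : ℕ) (α : ℝ≥0) : ℕ → ProbabilityMeasure I
  | 0 => diracProba oneHalf
  | ℓ + 1 => distRec k α (iter k α ℓ)

end KSat

end

/-! In terms of the odds `a / (1 - a)` the recursion becomes `Π⁺ / Π⁻ - Π⁺`, a difference of two
products over Poisson many i.i.d. clauses. Such products, and products of two of them built on the
same array, have explicit expectations through the Poisson generating function (`rowProd_moment`),
so L² distances between coupled outputs can be computed almost exactly.

The invariant `IsGood` says that the odds lie within `1 / (2k)` of `1` in L². Under it `∫ max(p,
p')²` is at most `(1 + 2/k) / 4`, so replacing `p` by `p'` changes an inverse clause by at most of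
order `k² 4⁻ᵏ D` in squared L² norm, where `D` is the squared L² distance of the odds. The Poisson
mean `r = αk/2` is of order `k 2ᵏ`. The ratio `Π⁺ / Π⁻` depends on the clauses only to second order
at the clause value `1`, so its squared error is `O(r k² 4⁻ᵏ D)`, that is `O(k³ 2⁻ᵏ D)`. The term
`Π⁺` lacks this cancellation and costs a factor `r²`, but its second moment is at most `exp(-k/4)`,
and `k⁴ exp(-k/4)` is still small. Hence for large `k` one step preserves the invariant
(`IsGood.recThrough`) and halves `D` (`IsGood.integral_recThrough_sub_sq_le`).

Coupling consecutive iterates through common Poisson variables and paired entries gives distance at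
most `2^(-ℓ)`, so integrals of Lipschitz functions are Cauchy; compactness of the space of measures
supplies the limit. The uniform second moment of the odds keeps mass away from `1`. The recursion is
weakly continuous at measures without an atom at `1`, since its discontinuities are then negligible,
and so the limit is a fixed point. -/

noncomputable section

namespace KSat

/-! ### Exact moments of products over Poisson many independent rows -/

/-- The Cauchy-Schwarz inequality for square integrable real functions. -/
theorem sq_integral_mul_le {Ω : Type*} [MeasurableSpace Ω] {ρ : Measure Ω} {f g : Ω → ℝ}
    (hf : MemLp f 2 ρ) (hg : MemLp g 2 ρ) :
    (∫ x, f x * g x ∂ρ) ^ 2 ≤ (∫ x, f x ^ 2 ∂ρ) * ∫ x, g x ^ 2 ∂ρ := by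
  have hfg : Integrable (fun x => f x * g x) ρ := hf.integrable_mul hg
  have key : ∀ t : ℝ, 0 ≤ (∫ x, f x ^ 2 ∂ρ) * (t * t) + (2 * ∫ x, f x * g x ∂ρ) * t
      + ∫ x, g x ^ 2 ∂ρ := by
    intro t
    have h : ∫ x, (t * f x + g x) ^ 2 ∂ρ = (∫ x, f x ^ 2 ∂ρ) * (t * t)
        + (2 * ∫ x, f x * g x ∂ρ) * t + ∫ x, g x ^ 2 ∂ρ := by
      have e : (fun x => (t * f x + g x) ^ 2)
          = fun x => (t * t * f x ^ 2 + 2 * t * (f x * g x)) + g x ^ 2 := by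
        funext x; ring
      have i1 : Integrable (fun x => t * t * f x ^ 2) ρ := hf.integrable_sq.const_mul _
      have i2 : Integrable (fun x => 2 * t * (f x * g x)) ρ := hfg.const_mul _
      have i3 : Integrable (fun x => t * t * f x ^ 2 + 2 * t * (f x * g x)) ρ := i1.add i2
      rw [e, integral_add i3 hg.integrable_sq, integral_add i1 i2, integral_const_mul,
        integral_const_mul]
      ring
    rw [← h]
    exact integral_nonneg fun x => sq_nonneg _
  have := discrim_le_zero key
  unfold discrim at this
  nlinarith

theorem integrable_pow_poissonMeasure (r : ℝ≥0) (c : ℝ) :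
    Integrable (fun n : ℕ => c ^ n) (poissonMeasure r) := by
  rw [integrable_poissonMeasure_iff]
  have h := (Real.summable_pow_div_factorial ((r : ℝ) * |c|)).mul_left (Real.exp (-r))
  refine h.congr fun n => ?_
  rw [norm_pow, Real.norm_eq_abs, mul_pow]
  ring

theorem integral_pow_poissonMeasure (r : ℝ≥0) (c : ℝ) :
    ∫ n, c ^ n ∂(poissonMeasure r) = Real.exp (r * (c - 1)) := by
  rw [integral_poissonMeasure]
  have h : HasSum (fun n : ℕ => ((r : ℝ) * c) ^ n / (n.factorial : ℝ)) (Real.exp (r * c)) := by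
    rw [Real.exp_eq_exp_ℝ]
    exact NormedSpace.expSeries_div_hasSum_exp ((r : ℝ) * c)
  have h2 := (h.mul_left (Real.exp (-r))).tsum_eq
  rw [← Real.exp_add] at h2
  rw [show (r : ℝ) * (c - 1) = -r + r * c by ring, ← h2]
  refine tsum_congr fun n => ?_
  rw [mul_pow, smul_eq_mul]
  ring

theorem integrable_prod_infinitePi {ι : Type*} {X : ι → Type*} [∀ i, MeasurableSpace (X i)]
    (μ : ∀ i, Measure (X i)) [∀ i, IsProbabilityMeasure (μ i)] (s : Finset ι)
    {f : ∀ i, X i → ℝ} (hf : ∀ i ∈ s, Integrable (f i) (μ i)) :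
    Integrable (fun ω => ∏ i ∈ s, f i (ω i)) (Measure.infinitePi μ) := by
  have h : Integrable (fun x : ∀ i : s, X i => ∏ i : s, f i (x i))
      (Measure.pi fun i : s => μ i) :=
    Integrable.fintype_prod_dep (f := fun (i : s) x => f i x) fun i => hf i i.2
  rw [← Measure.infinitePi_map_restrict μ] at h
  have h2 := h.comp_measurable (Finset.measurable_restrict s)
  refine h2.congr (Eventually.of_forall fun ω => ?_)
  simp only [Function.comp_apply, Finset.restrict]
  exact Finset.prod_coe_sort s fun i => f i (ω i)

theorem integral_prod_infinitePi {ι : Type*} {X : ι → Type*} [∀ i, MeasurableSpace (X i)]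
    (μ : ∀ i, Measure (X i)) [∀ i, IsProbabilityMeasure (μ i)] (s : Finset ι)
    {f : ∀ i, X i → ℝ} (hf : ∀ i ∈ s, Integrable (f i) (μ i)) :
    ∫ ω, ∏ i ∈ s, f i (ω i) ∂(Measure.infinitePi μ) = ∏ i ∈ s, ∫ x, f i x ∂(μ i) := by
  have h : Integrable (fun x : ∀ i : s, X i => ∏ i : s, f i (x i))
      (Measure.pi fun i : s => μ i) :=
    Integrable.fintype_prod_dep (f := fun (i : s) x => f i x) fun i => hf i i.2
  have h2 := integral_restrict_infinitePi (μ := μ) (s := s) h.aestronglyMeasurable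
  rw [integral_fintype_prod_eq_prod (fun (i : s) x => f i x),
    Finset.prod_coe_sort s fun i => ∫ x, f i x ∂(μ i)] at h2
  rw [← h2]
  refine integral_congr_ae (Eventually.of_forall fun ω => ?_)
  exact (Finset.prod_coe_sort s fun i => f i (ω i)).symm

/-- Regroups the flat array into independent signs, then rows, then entries, so that the product
formula can be applied at each level. -/
theorem measurePreserving_curry_infinitePi {E : Type*} [MeasurableSpace E] (ν : Measure E)
    [IsProbabilityMeasure ν] :
    MeasurePreserving (fun (η : Bool × ℕ × ℕ → E) (s : Bool) (i j : ℕ) => η (s, i, j))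
      (Measure.infinitePi fun _ => ν)
      (Measure.infinitePi fun _ : Bool => Measure.infinitePi fun _ : ℕ =>
        Measure.infinitePi fun _ : ℕ => ν) := by
  refine ⟨by fun_prop, ?_⟩
  have h1 := Measure.infinitePi_map_curry (ι := Bool) (κ := ℕ × ℕ) (fun _ _ => ν)
  have h2 := Measure.infinitePi_map_curry (ι := ℕ) (κ := ℕ) (fun _ _ => ν)
  have h3 := Measure.infinitePi_map_pi
    (μ := fun _ : Bool => Measure.infinitePi fun _ : ℕ × ℕ => ν)
    (f := fun _ => MeasurableEquiv.curry ℕ ℕ E) (fun _ => MeasurableEquiv.measurable _)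
  simp only [h2] at h3
  rw [← h3, ← h1, Measure.map_map (by fun_prop) (MeasurableEquiv.measurable _)]
  rfl

/-- The joint law of two independent Poisson variables and an independent array with i.i.d. entries
of law `ν`. -/
def arrayLaw {E : Type*} [MeasurableSpace E] (r : ℝ≥0) (ν : Measure E) :
    Measure ((ℕ × ℕ) × (Bool × ℕ × ℕ → E)) :=
  ((poissonMeasure r).prod (poissonMeasure r)).prod (Measure.infinitePi fun _ => ν)

instance {E : Type*} [MeasurableSpace E] (r : ℝ≥0) (ν : Measure E) [IsProbabilityMeasure ν] :
    IsProbabilityMeasure (arrayLaw r ν) := by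
  unfold arrayLaw; infer_instance

/-- The law of one row of the array. -/
abbrev rowLaw {E : Type*} [MeasurableSpace E] (ν : Measure E) : Measure (ℕ → E) :=
  Measure.infinitePi fun _ => ν

/-- The product of `f` over the first `d⁺` rows with sign `+` and of `g` over the first `d⁻` rows
with sign `-`. -/
def rowProd {E : Type*} (f g : (ℕ → E) → ℝ) (ω : (ℕ × ℕ) × (Bool × ℕ × ℕ → E)) : ℝ :=
  (∏ i ∈ Finset.range ω.1.1, f fun j => ω.2 (true, i, j)) *
    ∏ i ∈ Finset.range ω.1.2, g fun j => ω.2 (false, i, j)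

theorem measurable_rowProd {E : Type*} [MeasurableSpace E] {f g : (ℕ → E) → ℝ}
    (hf : Measurable f) (hg : Measurable g) : Measurable (rowProd f g) := by
  refine measurable_from_prod_countable_right fun d => ?_
  have h1 : Measurable fun η : Bool × ℕ × ℕ → E =>
      ∏ i ∈ Finset.range d.1, f fun j => η (true, i, j) :=
    Finset.measurable_fun_prod _ fun i _ => hf.comp (by fun_prop)
  have h2 : Measurable fun η : Bool × ℕ × ℕ → E =>
      ∏ i ∈ Finset.range d.2, g fun j => η (false, i, j) :=
    Finset.measurable_fun_prod _ fun i _ => hg.comp (by fun_prop)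
  exact h1.mul h2

theorem rowProd_fixed {E : Type*} [MeasurableSpace E] (ν : Measure E)
    [IsProbabilityMeasure ν] {f g : (ℕ → E) → ℝ}
    (hfi : Integrable f (rowLaw ν)) (hgi : Integrable g (rowLaw ν)) (d : ℕ × ℕ) :
    Integrable (fun η => rowProd f g (d, η)) (Measure.infinitePi fun _ : Bool × ℕ × ℕ => ν) ∧
    ∫ η, rowProd f g (d, η) ∂(Measure.infinitePi fun _ : Bool × ℕ × ℕ => ν) =
      (∫ ζ, f ζ ∂(rowLaw ν)) ^ d.1 * (∫ ζ, g ζ ∂(rowLaw ν)) ^ d.2 := by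
  have hmp := measurePreserving_curry_infinitePi ν
  set F : Bool → (ℕ → ℕ → E) → ℝ := fun s θ =>
    if s then ∏ i ∈ Finset.range d.1, f (θ i) else ∏ i ∈ Finset.range d.2, g (θ i) with hF
  have hFi : ∀ s ∈ (Finset.univ : Finset Bool),
      Integrable (F s) (Measure.infinitePi fun _ : ℕ => rowLaw ν) := by
    intro s _
    cases s
    · simpa [hF] using integrable_prod_infinitePi (fun _ : ℕ => rowLaw ν) (Finset.range d.2)
        (f := fun _ => g) fun i _ => hgi
    · simpa [hF] using integrable_prod_infinitePi (fun _ : ℕ => rowLaw ν) (Finset.range d.1)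
        (f := fun _ => f) fun i _ => hfi
  have e : (fun η : Bool × ℕ × ℕ → E => rowProd f g (d, η)) =
      (fun θ : Bool → ℕ → ℕ → E => ∏ s, F s (θ s)) ∘ fun η s i j => η (s, i, j) := by
    funext η
    simp [rowProd, hF]
  have h1 := integrable_prod_infinitePi
    (fun _ : Bool => Measure.infinitePi fun _ : ℕ => rowLaw ν) Finset.univ hFi
  have h2 := integral_prod_infinitePi
    (fun _ : Bool => Measure.infinitePi fun _ : ℕ => rowLaw ν) Finset.univ hFi
  refine ⟨by rw [e]; exact hmp.integrable_comp_of_integrable h1, ?_⟩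
  rw [e]
  simp only [Function.comp_def]
  rw [← hmp.map_eq] at h1 h2
  rw [integral_map hmp.aemeasurable h1.aestronglyMeasurable] at h2
  rw [h2]
  have h3 := integral_prod_infinitePi (fun _ : ℕ => rowLaw ν) (Finset.range d.1)
        (f := fun _ => f) fun i _ => hfi
  have h4 := integral_prod_infinitePi (fun _ : ℕ => rowLaw ν) (Finset.range d.2)
        (f := fun _ => g) fun i _ => hgi
  simp only [Finset.prod_const, Finset.card_range] at h3 h4
  simp [hF, h3, h4]

/-- Given the row counts, independence turns the expectation into `(∫ f) ^ d⁺ * (∫ g) ^ d⁻`;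
averaging over the counts applies the Poisson generating function twice. As `rowProd` is
multiplicative, this also covers second and mixed moments. -/
theorem rowProd_moment {E : Type*} [MeasurableSpace E] (r : ℝ≥0) (ν : Measure E)
    [IsProbabilityMeasure ν] {f g : (ℕ → E) → ℝ} (hf : Measurable f) (hg : Measurable g)
    (hf0 : ∀ ζ, 0 ≤ f ζ) (hg0 : ∀ ζ, 0 ≤ g ζ)
    (hfi : Integrable f (rowLaw ν)) (hgi : Integrable g (rowLaw ν)) :
    Integrable (rowProd f g) (arrayLaw r ν) ∧
    ∫ ω, rowProd f g ω ∂(arrayLaw r ν) =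
      Real.exp (r * (∫ ζ, f ζ ∂(rowLaw ν) - 1) + r * (∫ ζ, g ζ ∂(rowLaw ν) - 1)) := by
  have hfix := rowProd_fixed ν hfi hgi
  have hpois : Integrable (fun d : ℕ × ℕ => (∫ ζ, f ζ ∂(rowLaw ν)) ^ d.1 *
      (∫ ζ, g ζ ∂(rowLaw ν)) ^ d.2) ((poissonMeasure r).prod (poissonMeasure r)) :=
    (integrable_pow_poissonMeasure r _).mul_prod (integrable_pow_poissonMeasure r _)
  have hnn : ∀ ω : (ℕ × ℕ) × (Bool × ℕ × ℕ → E), 0 ≤ rowProd f g ω := fun ω =>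
    mul_nonneg (Finset.prod_nonneg fun _ _ => hf0 _) (Finset.prod_nonneg fun _ _ => hg0 _)
  have hint : Integrable (rowProd f g) (arrayLaw r ν) := by
    unfold arrayLaw
    rw [integrable_prod_iff (measurable_rowProd hf hg).aestronglyMeasurable]
    refine ⟨Eventually.of_forall fun d => (hfix d).1, ?_⟩
    refine hpois.congr (Eventually.of_forall fun d => ?_)
    simp only [Real.norm_of_nonneg (hnn _)]
    exact (hfix d).2.symm
  refine ⟨hint, ?_⟩
  unfold arrayLaw at hint ⊢
  rw [integral_prod _ hint]
  simp only [fun d => (hfix d).2]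
  rw [integral_prod_mul (fun n : ℕ => (∫ ζ, f ζ ∂(rowLaw ν)) ^ n)
    (fun n : ℕ => (∫ ζ, g ζ ∂(rowLaw ν)) ^ n), integral_pow_poissonMeasure,
    integral_pow_poissonMeasure, Real.exp_add]

/-! ### L² estimates for `Π⁺ / Π⁻` and `Π⁺` -/

/-- The left side is `(e^(a/2) - e^(b/2))² + 2 (e^((a+b)/2) - e^c)`, and each part is bounded by `1
- e^(-t) ≤ t`. In the applications `a`, `b` are the exponents of two second moments and `c` that of
the mixed moment. -/
theorem exp_add_exp_sub_le {a b c M : ℝ} (hc : 2 * c ≤ a + b) (ha : a ≤ M) (hb : b ≤ M) :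
    Real.exp a + Real.exp b - 2 * Real.exp c ≤
      Real.exp M * ((a - b) ^ 2 / 4 + (a + b - 2 * c)) := by
  have half : ∀ a b : ℝ, b ≤ a → a ≤ M →
      (Real.exp (a / 2) - Real.exp (b / 2)) ^ 2 ≤ Real.exp M * ((a - b) ^ 2 / 4) := by
    intro a b hba haM
    have e : Real.exp (b / 2) = Real.exp (a / 2) * Real.exp (-((a - b) / 2)) := by
      rw [← Real.exp_add]; congr 1; ring
    have h1 := Real.add_one_le_exp (-((a - b) / 2))
    have h2 : Real.exp (-((a - b) / 2)) ≤ 1 := Real.exp_le_one_iff.2 (by linarith)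
    have h3 : (1 - Real.exp (-((a - b) / 2))) ^ 2 ≤ ((a - b) / 2) ^ 2 :=
      pow_le_pow_left₀ (by linarith) (by linarith) 2
    have h4 : Real.exp (a / 2) ^ 2 = Real.exp a := by
      rw [← Real.exp_nat_mul]; congr 1; push_cast; ring
    have h5 : Real.exp a ≤ Real.exp M := Real.exp_le_exp.2 haM
    calc (Real.exp (a / 2) - Real.exp (b / 2)) ^ 2
        = Real.exp a * (1 - Real.exp (-((a - b) / 2))) ^ 2 := by rw [e, ← h4]; ring
      _ ≤ Real.exp M * ((a - b) / 2) ^ 2 := by gcongr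
      _ = _ := by ring
  have hsq : (Real.exp (a / 2) - Real.exp (b / 2)) ^ 2 ≤ Real.exp M * ((a - b) ^ 2 / 4) := by
    rcases le_total b a with h | h
    · exact half a b h ha
    · have := half b a h hb
      calc _ = (Real.exp (b / 2) - Real.exp (a / 2)) ^ 2 := by ring
        _ ≤ _ := this
        _ = _ := by ring
  have h4 : ∀ a : ℝ, Real.exp (a / 2) ^ 2 = Real.exp a := fun a => by
    rw [← Real.exp_nat_mul]; congr 1; push_cast; ring
  have hm : Real.exp ((a + b) / 2) = Real.exp (a / 2) * Real.exp (b / 2) := by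
    rw [← Real.exp_add]; congr 1; ring
  have e : Real.exp c = Real.exp ((a + b) / 2) * Real.exp (-((a + b) / 2 - c)) := by
    rw [← Real.exp_add]; congr 1; ring
  have h1 := Real.add_one_le_exp (-((a + b) / 2 - c))
  have h5 : Real.exp ((a + b) / 2) ≤ Real.exp M := Real.exp_le_exp.2 (by linarith)
  have h6 : Real.exp ((a + b) / 2) - Real.exp c ≤ Real.exp M * ((a + b) / 2 - c) := by
    calc _ = Real.exp ((a + b) / 2) * (1 - Real.exp (-((a + b) / 2 - c))) := by rw [e]; ring
      _ ≤ Real.exp ((a + b) / 2) * ((a + b) / 2 - c) :=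
        mul_le_mul_of_nonneg_left (by linarith) (Real.exp_nonneg _)
      _ ≤ _ := mul_le_mul_of_nonneg_right h5 (by linarith)
  have h7 := h4 a
  have h8 := h4 b
  nlinarith

section SquareIntegrable

variable {Ω : Type*} [MeasurableSpace Ω] {ρ : Measure Ω} {f g : Ω → ℝ}

theorem integral_sub_sq (hf : MemLp f 2 ρ) (hg : MemLp g 2 ρ) :
    ∫ x, (f x - g x) ^ 2 ∂ρ
      = ∫ x, f x * f x ∂ρ + ∫ x, g x * g x ∂ρ - 2 * ∫ x, f x * g x ∂ρ := by
  have i1 : Integrable (fun x => f x * f x) ρ := hf.integrable_mul hf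
  have i2 : Integrable (fun x => g x * g x) ρ := hg.integrable_mul hg
  have i3 : Integrable (fun x => 2 * (f x * g x)) ρ := (hf.integrable_mul hg).const_mul 2
  have i4 : Integrable (fun x => f x * f x + g x * g x) ρ := i1.add i2
  rw [← integral_const_mul, ← integral_add i1 i2, ← integral_sub i4 i3]
  congr 1
  funext x
  ring

theorem integral_sq_sub_sq (hf : MemLp f 2 ρ) (hg : MemLp g 2 ρ) :
    ∫ x, f x * f x ∂ρ - ∫ x, g x * g x ∂ρ = ∫ x, (f x - g x) * (f x + g x) ∂ρ := by
  have i1 : Integrable (fun x => f x * f x) ρ := hf.integrable_mul hf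
  have i2 : Integrable (fun x => g x * g x) ρ := hg.integrable_mul hg
  rw [← integral_sub i1 i2]
  congr 1
  funext x
  ring

theorem integral_add_sq_le (hf : MemLp f 2 ρ) (hg : MemLp g 2 ρ) :
    ∫ x, (f x + g x) ^ 2 ∂ρ ≤ 2 * (∫ x, f x ^ 2 ∂ρ + ∫ x, g x ^ 2 ∂ρ) := by
  have i1 := hf.integrable_sq
  have i2 := hg.integrable_sq
  have i3 : Integrable (fun x => 2 * (f x ^ 2 + g x ^ 2)) ρ := (i1.add i2).const_mul 2
  rw [← integral_add i1 i2, ← integral_const_mul]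
  exact integral_mono (hf.add hg).integrable_sq i3 fun x => by
    dsimp only; nlinarith [sq_nonneg (f x - g x)]

end SquareIntegrable

/-- A function of a row with values in `[0,1]`, almost surely positive, whose inverse is square
integrable. -/
structure IsClause {E : Type*} [MeasurableSpace E] (ν : Measure E) (X : (ℕ → E) → ℝ) : Prop where
  meas : Measurable X
  nonneg : ∀ ζ, 0 ≤ X ζ
  le_one : ∀ ζ, X ζ ≤ 1
  pos : ∀ᵐ ζ ∂(rowLaw ν), 0 < X ζ
  memLp : MemLp (fun ζ => (X ζ)⁻¹) 2 (rowLaw ν)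

theorem rowProd_mul {E : Type*} (f g f' g' : (ℕ → E) → ℝ)
    (ω : (ℕ × ℕ) × (Bool × ℕ × ℕ → E)) :
    rowProd f g ω * rowProd f' g' ω = rowProd (fun ζ => f ζ * f' ζ) (fun ζ => g ζ * g' ζ) ω := by
  simp only [rowProd, Finset.prod_mul_distrib]
  ring

/-- The second quantity is the increment of `x² + x⁻²`, whose derivative vanishes at `x = 1`. This
is the source of the extra factor measuring the distance of `x⁻¹` and `x'⁻¹` from `1`. -/
theorem inv_sub_inv_bounds {x x' : ℝ} (h0 : 0 < x) (h1 : x ≤ 1) (h0' : 0 < x') (h1' : x' ≤ 1) :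
    |x - x'| ≤ |x⁻¹ - x'⁻¹| ∧
    |(x - x') * (x + x') + (x⁻¹ - x'⁻¹) * (x⁻¹ + x'⁻¹)| ≤
      4 * (|x⁻¹ - x'⁻¹| * ((x⁻¹ - 1) + (x'⁻¹ - 1))) := by
  have hz : 1 ≤ x⁻¹ := (one_le_inv₀ h0).2 h1
  have hz' : 1 ≤ x'⁻¹ := (one_le_inv₀ h0').2 h1'
  have e : x - x' = -((x⁻¹ - x'⁻¹) * (x * x')) := by field_simp; ring
  have hxx : x * x' ≤ 1 := mul_le_one₀ h1 h0'.le h1'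
  have hxx0 : 0 ≤ x * x' := by positivity
  constructor
  · rw [e, abs_neg, abs_mul, abs_of_nonneg hxx0]
    exact mul_le_of_le_one_right (abs_nonneg _) hxx
  · have e2 : (x - x') * (x + x') + (x⁻¹ - x'⁻¹) * (x⁻¹ + x'⁻¹) =
        (x⁻¹ - x'⁻¹) * (x⁻¹ + x'⁻¹ - x * x' * (x + x')) := by
      nth_rewrite 1 [e]; ring
    have hw : 1 - x ≤ x⁻¹ - 1 := by
      have : x⁻¹ * x = 1 := inv_mul_cancel₀ h0.ne'
      nlinarith
    have hw' : 1 - x' ≤ x'⁻¹ - 1 := by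
      have : x'⁻¹ * x' = 1 := inv_mul_cancel₀ h0'.ne'
      nlinarith
    have hlow : 2 - 3 * (1 - x) - 3 * (1 - x') ≤ x * x' * (x + x') := by
      have p1 : 0 ≤ (1 - x) * (1 - x') := mul_nonneg (by linarith) (by linarith)
      have p2 : 0 ≤ (1 - x) * (1 - x') * (x + x') := mul_nonneg p1 (by linarith)
      linarith [sq_nonneg (2 - x - x'), show x * x' * (x + x') - (2 - 3 * (1 - x) - 3 * (1 - x')) =
        (2 - x - x') ^ 2 + (1 - x) * (1 - x') * (x + x') by ring]
    have hup : x * x' * (x + x') ≤ 2 :=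
      (mul_le_of_le_one_left (by linarith) hxx).trans (by linarith)
    rw [e2, abs_mul, abs_of_nonneg (by linarith : 0 ≤ x⁻¹ + x'⁻¹ - x * x' * (x + x'))]
    have : x⁻¹ + x'⁻¹ - x * x' * (x + x') ≤ 4 * ((x⁻¹ - 1) + (x'⁻¹ - 1)) := by linarith
    calc _ ≤ |x⁻¹ - x'⁻¹| * (4 * ((x⁻¹ - 1) + (x'⁻¹ - 1))) :=
          mul_le_mul_of_nonneg_left this (abs_nonneg _)
      _ = _ := by ring

section Clauses

variable {E : Type*} [MeasurableSpace E] {ν : Measure E} [IsProbabilityMeasure ν]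
  {X X' : (ℕ → E) → ℝ}

theorem IsClause.memLp_self (h : IsClause ν X) : MemLp X 2 (rowLaw ν) :=
  MemLp.of_bound h.meas.aestronglyMeasurable 1 (Eventually.of_forall fun ζ => by
    rw [Real.norm_of_nonneg (h.nonneg ζ)]; exact h.le_one ζ)

theorem IsClause.one : IsClause ν fun _ => 1 where
  meas := measurable_const
  nonneg _ := zero_le_one
  le_one _ := le_rfl
  pos := Eventually.of_forall fun _ => one_pos
  memLp := memLp_const _

/-- The number `Π⁺ / Π⁻`. -/
def ratio (X : (ℕ → E) → ℝ) : (ℕ × ℕ) × (Bool × ℕ × ℕ → E) → ℝ :=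
  rowProd X fun ζ => (X ζ)⁻¹

/-- The number `Π⁺`. -/
def numer (X : (ℕ → E) → ℝ) : (ℕ × ℕ) × (Bool × ℕ × ℕ → E) → ℝ :=
  rowProd X fun _ => 1

theorem ratio_mul_moment (r : ℝ≥0) (h : IsClause ν X) (h' : IsClause ν X') :
    Integrable (fun ω => ratio X ω * ratio X' ω) (arrayLaw r ν) ∧
    ∫ ω, ratio X ω * ratio X' ω ∂(arrayLaw r ν) =
      Real.exp (r * (∫ ζ, X ζ * X' ζ ∂(rowLaw ν) + ∫ ζ, (X ζ)⁻¹ * (X' ζ)⁻¹ ∂(rowLaw ν) - 2)) := by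
  have := rowProd_moment r ν (f := fun ζ => X ζ * X' ζ) (g := fun ζ => (X ζ)⁻¹ * (X' ζ)⁻¹)
    (h.meas.mul h'.meas) (h.meas.inv.mul h'.meas.inv)
    (fun ζ => mul_nonneg (h.nonneg ζ) (h'.nonneg ζ))
    (fun ζ => mul_nonneg (inv_nonneg.2 (h.nonneg ζ)) (inv_nonneg.2 (h'.nonneg ζ)))
    (h.memLp_self.integrable_mul h'.memLp_self) (h.memLp.integrable_mul h'.memLp)
  simp only [ratio, rowProd_mul]
  refine ⟨this.1, this.2.trans ?_⟩
  congr 1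
  ring

theorem numer_mul_moment (r : ℝ≥0) (h : IsClause ν X) (h' : IsClause ν X') :
    Integrable (fun ω => numer X ω * numer X' ω) (arrayLaw r ν) ∧
    ∫ ω, numer X ω * numer X' ω ∂(arrayLaw r ν) =
      Real.exp (r * (∫ ζ, X ζ * X' ζ ∂(rowLaw ν) - 1)) := by
  have := rowProd_moment r ν (f := fun ζ => X ζ * X' ζ) (g := fun ζ => 1 * 1)
    (h.meas.mul h'.meas) measurable_const
    (fun ζ => mul_nonneg (h.nonneg ζ) (h'.nonneg ζ)) (fun ζ => by norm_num)
    (h.memLp_self.integrable_mul h'.memLp_self) (integrable_const _)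
  simp only [numer, rowProd_mul]
  refine ⟨this.1, this.2.trans ?_⟩
  simp

theorem memLp_ratio (r : ℝ≥0) (h : IsClause ν X) : MemLp (ratio X) 2 (arrayLaw r ν) := by
  have hm : Measurable (ratio X) := measurable_rowProd h.meas h.meas.inv
  rw [memLp_two_iff_integrable_sq hm.aestronglyMeasurable]
  simpa only [sq] using (ratio_mul_moment r h h).1

theorem memLp_numer (r : ℝ≥0) (h : IsClause ν X) : MemLp (numer X) 2 (arrayLaw r ν) := by
  have hm : Measurable (numer X) := measurable_rowProd h.meas measurable_const
  rw [memLp_two_iff_integrable_sq hm.aestronglyMeasurable]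
  simpa only [sq] using (numer_mul_moment r h h).1

theorem integral_sub_sq_le_inv (h : IsClause ν X) (h' : IsClause ν X') :
    ∫ ζ, (X ζ - X' ζ) ^ 2 ∂(rowLaw ν) ≤ ∫ ζ, ((X ζ)⁻¹ - (X' ζ)⁻¹) ^ 2 ∂(rowLaw ν) := by
  refine integral_mono_ae (h.memLp_self.sub h'.memLp_self).integrable_sq
    (h.memLp.sub h'.memLp).integrable_sq ?_
  filter_upwards [h.pos, h'.pos] with ζ p p'
  exact sq_le_sq.2 (inv_sub_inv_bounds p (h.le_one ζ) p' (h'.le_one ζ)).1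

/-- Because `x² + x⁻² - 2 = (x⁻¹ - x)²`, the exponent of the second moment of the ratio is of second
order in `x⁻¹ - 1`. -/
theorem exponent_le (h : IsClause ν X) :
    ∫ ζ, X ζ * X ζ ∂(rowLaw ν) + ∫ ζ, (X ζ)⁻¹ * (X ζ)⁻¹ ∂(rowLaw ν) - 2 ≤
      4 * ∫ ζ, ((X ζ)⁻¹ - 1) ^ 2 ∂(rowLaw ν) := by
  have e := integral_sub_sq h.memLp h.memLp_self
  have e1 : ∫ ζ, (X ζ)⁻¹ * X ζ ∂(rowLaw ν) = 1 := by
    rw [integral_congr_ae (g := fun _ => (1 : ℝ))]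
    · simp
    · filter_upwards [h.pos] with ζ p
      exact inv_mul_cancel₀ p.ne'
  have hle : ∫ ζ, ((X ζ)⁻¹ - X ζ) ^ 2 ∂(rowLaw ν) ≤
      ∫ ζ, 4 * ((X ζ)⁻¹ - 1) ^ 2 ∂(rowLaw ν) := by
    refine integral_mono_ae (h.memLp.sub h.memLp_self).integrable_sq
      ((h.memLp.sub (memLp_const 1)).integrable_sq.const_mul 4) ?_
    filter_upwards [h.pos] with ζ p
    have hz : 1 ≤ (X ζ)⁻¹ := (one_le_inv₀ p).2 (h.le_one ζ)
    have hm : (X ζ)⁻¹ * X ζ = 1 := inv_mul_cancel₀ p.ne'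
    have h1 := h.le_one ζ
    have : (X ζ)⁻¹ - X ζ ≤ 2 * ((X ζ)⁻¹ - 1) := by nlinarith
    calc ((X ζ)⁻¹ - X ζ) ^ 2 ≤ (2 * ((X ζ)⁻¹ - 1)) ^ 2 :=
          pow_le_pow_left₀ (by linarith) this 2
      _ = _ := by ring
  rw [integral_const_mul] at hle
  linarith

/-- The `L²` distance of two coupled ratios is controlled by that of the inverse clauses. -/
theorem integral_ratio_sub_sq_le (r : ℝ≥0) (h : IsClause ν X) (h' : IsClause ν X')
    (hS : (r : ℝ) * ∫ ζ, ((X ζ)⁻¹ - 1) ^ 2 ∂(rowLaw ν) ≤ 1 / 16)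
    (hS' : (r : ℝ) * ∫ ζ, ((X' ζ)⁻¹ - 1) ^ 2 ∂(rowLaw ν) ≤ 1 / 16) :
    ∫ ω, (ratio X ω - ratio X' ω) ^ 2 ∂(arrayLaw r ν) ≤
      6 * ((r : ℝ) * ∫ ζ, ((X ζ)⁻¹ - (X' ζ)⁻¹) ^ 2 ∂(rowLaw ν)) := by
  have hr : (0 : ℝ) ≤ r := r.2
  rw [integral_sub_sq (memLp_ratio r h) (memLp_ratio r h'), (ratio_mul_moment r h h).2,
    (ratio_mul_moment r h' h').2, (ratio_mul_moment r h h').2]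
  have ea := exponent_le h
  have eb := exponent_le h'
  have eX := integral_sub_sq h.memLp_self h'.memLp_self
  have eZ := integral_sub_sq h.memLp h'.memLp
  have dX := integral_sq_sub_sq h.memLp_self h'.memLp_self
  have dZ := integral_sq_sub_sq h.memLp h'.memLp
  have hXZ := integral_sub_sq_le_inv h h'
  have hX0 : 0 ≤ ∫ ζ, (X ζ - X' ζ) ^ 2 ∂(rowLaw ν) := integral_nonneg fun _ => sq_nonneg _
  have mW : MemLp (fun ζ => (X ζ)⁻¹ - 1) 2 (rowLaw ν) := h.memLp.sub (memLp_const 1)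
  have mW' : MemLp (fun ζ => (X' ζ)⁻¹ - 1) 2 (rowLaw ν) := h'.memLp.sub (memLp_const 1)
  have mD : MemLp (fun ζ => (X ζ)⁻¹ - (X' ζ)⁻¹) 2 (rowLaw ν) := h.memLp.sub h'.memLp
  have mA : MemLp (fun ζ => |(X ζ)⁻¹ - (X' ζ)⁻¹|) 2 (rowLaw ν) := mD.abs
  have mWW : MemLp (fun ζ => ((X ζ)⁻¹ - 1) + ((X' ζ)⁻¹ - 1)) 2 (rowLaw ν) := mW.add mW'
  have hCS := sq_integral_mul_le mA mWW
  simp only [sq_abs] at hCS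
  have hWW := integral_add_sq_le mW mW'
  have i1 : Integrable (fun ζ => (X ζ - X' ζ) * (X ζ + X' ζ)) (rowLaw ν) :=
    (h.memLp_self.sub h'.memLp_self).integrable_mul (h.memLp_self.add h'.memLp_self)
  have i2 : Integrable (fun ζ => ((X ζ)⁻¹ - (X' ζ)⁻¹) * ((X ζ)⁻¹ + (X' ζ)⁻¹)) (rowLaw ν) :=
    mD.integrable_mul (h.memLp.add h'.memLp)
  have i3 : Integrable (fun ζ => |(X ζ)⁻¹ - (X' ζ)⁻¹| * (((X ζ)⁻¹ - 1) + ((X' ζ)⁻¹ - 1)))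
    (rowLaw ν) := mA.integrable_mul mWW
  have hdiff : |∫ ζ, (X ζ - X' ζ) * (X ζ + X' ζ) ∂(rowLaw ν) +
      ∫ ζ, ((X ζ)⁻¹ - (X' ζ)⁻¹) * ((X ζ)⁻¹ + (X' ζ)⁻¹) ∂(rowLaw ν)| ≤
      4 * ∫ ζ, |(X ζ)⁻¹ - (X' ζ)⁻¹| * (((X ζ)⁻¹ - 1) + ((X' ζ)⁻¹ - 1)) ∂(rowLaw ν) := by
    rw [← integral_add i1 i2, ← integral_const_mul]
    refine (abs_integral_le_integral_abs).trans (integral_mono_ae (i1.add i2).abs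
      (i3.const_mul 4) ?_)
    filter_upwards [h.pos, h'.pos] with ζ p p'
    exact (inv_sub_inv_bounds p (h.le_one ζ) p' (h'.le_one ζ)).2
  set S := ∫ ζ, ((X ζ)⁻¹ - 1) ^ 2 ∂(rowLaw ν)
  set S' := ∫ ζ, ((X' ζ)⁻¹ - 1) ^ 2 ∂(rowLaw ν)
  set Δ := ∫ ζ, ((X ζ)⁻¹ - (X' ζ)⁻¹) ^ 2 ∂(rowLaw ν)
  set T := ∫ ζ, |(X ζ)⁻¹ - (X' ζ)⁻¹| * (((X ζ)⁻¹ - 1) + ((X' ζ)⁻¹ - 1)) ∂(rowLaw ν)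
  set V := ∫ ζ, (X ζ - X' ζ) ^ 2 ∂(rowLaw ν)
  rw [← dX, ← dZ] at hdiff
  set xx := ∫ ζ, X ζ * X ζ ∂(rowLaw ν)
  set yy := ∫ ζ, X' ζ * X' ζ ∂(rowLaw ν)
  set xy := ∫ ζ, X ζ * X' ζ ∂(rowLaw ν)
  set zz := ∫ ζ, (X ζ)⁻¹ * (X ζ)⁻¹ ∂(rowLaw ν)
  set ww := ∫ ζ, (X' ζ)⁻¹ * (X' ζ)⁻¹ ∂(rowLaw ν)
  set zw := ∫ ζ, (X ζ)⁻¹ * (X' ζ)⁻¹ ∂(rowLaw ν)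
  have hΔ0 : 0 ≤ Δ := hX0.trans hXZ
  -- The mixed term completes the squares: only the L² distances of the clauses and of their
  -- inverses remain.
  have hsum : r * (xx + zz - 2) + r * (yy + ww - 2) - 2 * (r * (xy + zw - 2)) = r * (V + Δ) := by
    rw [eX, eZ]; ring
  have hrV : 0 ≤ r * (V + Δ) := by positivity
  have hrVΔ : r * (V + Δ) ≤ r * (2 * Δ) := by gcongr; linarith
  have hra : r * (xx + zz - 2) ≤ 1 / 4 := by nlinarith
  have hrb : r * (yy + ww - 2) ≤ 1 / 4 := by nlinarith
  refine (exp_add_exp_sub_le (M := 1 / 4) (by linarith) hra hrb).trans ?_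
  -- Cauchy-Schwarz gives a bound quadratic in `r`; the smallness of `r * (S + S')` absorbs one
  -- factor `r`.
  have hsq : (r * (xx + zz - 2) - r * (yy + ww - 2)) ^ 2 / 4 ≤ r * Δ := by
    have h1 : (xx - yy + (zz - ww)) ^ 2 ≤ (4 * T) ^ 2 := by
      rw [← sq_abs]; exact pow_le_pow_left₀ (abs_nonneg _) hdiff 2
    have h2 : (xx - yy + (zz - ww)) ^ 2 ≤ 32 * (Δ * (S + S')) := by
      have : T ^ 2 ≤ Δ * (2 * (S + S')) := hCS.trans (mul_le_mul_of_nonneg_left hWW hΔ0)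
      nlinarith
    have h3 : r * (S + S') ≤ 1 / 8 := by linarith
    calc _ = (r * r) * (xx - yy + (zz - ww)) ^ 2 / 4 := by ring
      _ ≤ (r * r) * (32 * (Δ * (S + S'))) / 4 := by gcongr
      _ = 8 * (r * Δ) * (r * (S + S')) := by ring
      _ ≤ 8 * (r * Δ) * (1 / 8) := by gcongr
      _ = _ := by ring
  have hexp : Real.exp (1 / 4) ≤ 2 := by
    have h1 := Real.exp_bound_div_one_sub_of_interval (x := 1 / 4) (by norm_num) (by norm_num)
    linarith
  rw [hsum]
  calc _ ≤ 2 * (r * Δ + r * (2 * Δ)) :=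
        mul_le_mul hexp (by linarith) (by positivity) (by norm_num)
    _ = _ := by ring

/-- The exponent is `r (∫ X² - 1)`, and `X² ≤ X` because clauses lie in `[0,1]`. -/
theorem integral_numer_sq_le (r : ℝ≥0) (h : IsClause ν X) {b : ℝ}
    (hb : b ≤ r * (1 - ∫ ζ, X ζ ∂(rowLaw ν))) :
    ∫ ω, numer X ω ^ 2 ∂(arrayLaw r ν) ≤ Real.exp (-b) := by
  simp only [sq]
  rw [(numer_mul_moment r h h).2]
  refine Real.exp_le_exp.2 ?_
  have : ∫ ζ, X ζ * X ζ ∂(rowLaw ν) ≤ ∫ ζ, X ζ ∂(rowLaw ν) :=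
    integral_mono (h.memLp_self.integrable_mul h.memLp_self)
      (h.memLp_self.integrable one_le_two) fun ζ =>
      mul_le_of_le_one_right (h.nonneg ζ) (h.le_one ζ)
  nlinarith [r.2]

/-- The increment of `x²` has no cancellation at `x = 1`, so the squared difference of exponents
keeps its factor `r²`. The factor `exp(-b)` is there to compensate. -/
theorem integral_numer_sub_sq_le (r : ℝ≥0) (h : IsClause ν X) (h' : IsClause ν X') {b : ℝ}
    (hb : b ≤ r * (1 - ∫ ζ, X ζ ∂(rowLaw ν))) (hb' : b ≤ r * (1 - ∫ ζ, X' ζ ∂(rowLaw ν))) :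
    ∫ ω, (numer X ω - numer X' ω) ^ 2 ∂(arrayLaw r ν) ≤
      Real.exp (-b) * ((r ^ 2 + r) * ∫ ζ, ((X ζ)⁻¹ - (X' ζ)⁻¹) ^ 2 ∂(rowLaw ν)) := by
  have hr : (0 : ℝ) ≤ r := r.2
  have ha := integral_numer_sq_le r h hb
  have ha' := integral_numer_sq_le r h' hb'
  simp only [sq] at ha ha'
  rw [(numer_mul_moment r h h).2] at ha
  rw [(numer_mul_moment r h' h').2] at ha'
  rw [Real.exp_le_exp] at ha ha'
  rw [integral_sub_sq (memLp_numer r h) (memLp_numer r h'), (numer_mul_moment r h h).2,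
    (numer_mul_moment r h' h').2, (numer_mul_moment r h h').2]
  have eX := integral_sub_sq h.memLp_self h'.memLp_self
  have dX := integral_sq_sub_sq h.memLp_self h'.memLp_self
  have hXZ := integral_sub_sq_le_inv h h'
  have hX0 : 0 ≤ ∫ ζ, (X ζ - X' ζ) ^ 2 ∂(rowLaw ν) := integral_nonneg fun _ => sq_nonneg _
  have mD := h.memLp_self.sub h'.memLp_self
  have mP : MemLp (X + X') 2 (rowLaw ν) := h.memLp_self.add h'.memLp_self
  have hCS := sq_integral_mul_le mD mP
  have hP : ∫ ζ, (X + X') ζ ^ 2 ∂(rowLaw ν) ≤ 4 := by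
    have : ∫ ζ, (X + X') ζ ^ 2 ∂(rowLaw ν) ≤ ∫ ζ, (4 : ℝ) ∂(rowLaw ν) :=
      integral_mono mP.integrable_sq (integrable_const _) fun ζ => by
        have h1 := h.nonneg ζ
        have h2 := h'.nonneg ζ
        have h3 := h.le_one ζ
        have h4 := h'.le_one ζ
        simp only [Pi.add_apply]
        nlinarith
    simpa using this
  simp only [Pi.sub_apply, Pi.add_apply] at hCS hP
  rw [← dX] at hCS
  set Δ := ∫ ζ, ((X ζ)⁻¹ - (X' ζ)⁻¹) ^ 2 ∂(rowLaw ν)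
  set V := ∫ ζ, (X ζ - X' ζ) ^ 2 ∂(rowLaw ν)
  set xx := ∫ ζ, X ζ * X ζ ∂(rowLaw ν)
  set yy := ∫ ζ, X' ζ * X' ζ ∂(rowLaw ν)
  set xy := ∫ ζ, X ζ * X' ζ ∂(rowLaw ν)
  have hsum : r * (xx - 1) + r * (yy - 1) - 2 * (r * (xy - 1)) = r * V := by
    rw [eX]; ring
  have hrV : 0 ≤ r * V := by positivity
  refine (exp_add_exp_sub_le (by linarith) ha ha').trans ?_
  refine mul_le_mul_of_nonneg_left ?_ (Real.exp_nonneg _)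
  have h2 : (xx - yy) ^ 2 ≤ V * 4 := hCS.trans (mul_le_mul_of_nonneg_left hP hX0)
  rw [hsum]
  calc (r * (xx - 1) - r * (yy - 1)) ^ 2 / 4 + r * V
      = (r * r) * (xx - yy) ^ 2 / 4 + r * V := by ring
    _ ≤ (r * r) * (Δ * 4) / 4 + r * Δ := by
      have : (xx - yy) ^ 2 ≤ Δ * 4 := by linarith
      gcongr
    _ = _ := by ring

end Clauses

/-! ### Odds, and the sensitivity of one clause to its entries -/

/-- The odds `a / (1 - a)` of a probability `a`. -/
def odds (a : ℝ) : ℝ := a / (1 - a)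

theorem measurable_odds : Measurable odds := by
  unfold odds
  fun_prop

theorem odds_sub_odds {a b : ℝ} (ha : a < 1) (hb : b < 1) :
    odds a - odds b = (a - b) / ((1 - a) * (1 - b)) := by
  have h1 : 1 - a ≠ 0 := by linarith
  have h2 : 1 - b ≠ 0 := by linarith
  unfold odds
  field_simp
  ring

theorem abs_sub_le_abs_odds_sub {a b : ℝ} (ha0 : 0 ≤ a) (ha : a < 1) (hb0 : 0 ≤ b) (hb : b < 1) :
    |a - b| ≤ |odds a - odds b| := by
  rw [odds_sub_odds ha hb, abs_div]
  have h : 0 < (1 - a) * (1 - b) := mul_pos (by linarith) (by linarith)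
  rw [abs_of_pos h, le_div_iff₀ h]
  exact mul_le_of_le_one_right (abs_nonneg _) (mul_le_one₀ (by linarith) (by linarith) (by linarith))

/-- Since `1 + odds a = 1 / (1 - a)`, this is `a (1 - a) ≤ 1/4`, sharp at `a = 1/2`. -/
theorem le_one_add_odds_div {a : ℝ} (ha : a < 1) : a ≤ (1 + odds a) / 4 := by
  have h : 0 < 1 - a := by linarith
  have : 1 + odds a = 1 / (1 - a) := by unfold odds; field_simp; ring
  rw [this, div_div, le_div_iff₀ (by linarith)]
  nlinarith [sq_nonneg (2 * a - 1)]

theorem half_sub_odds_le {a : ℝ} (ha0 : 0 ≤ a) (ha : a < 1) : 1 / 2 - |odds a - 1| / 2 ≤ a := by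
  have h : 0 < 1 - a := by linarith
  have e : odds a - 1 = (2 * a - 1) / (1 - a) := by unfold odds; field_simp; ring
  rcases le_total (1 / 2) a with h2 | h2
  · linarith [abs_nonneg (odds a - 1)]
  · have : 1 - 2 * a ≤ |odds a - 1| := by
      rw [e, abs_div, abs_of_pos h, abs_of_nonpos (by linarith), le_div_iff₀ h]
      nlinarith
    linarith

/-- The factors are exchanged one at a time, all others being bounded by the maximum. -/
theorem abs_prod_sub_prod_le {ι : Type*} [DecidableEq ι] (s : Finset ι) {a b : ι → ℝ}
    (ha : ∀ i, 0 ≤ a i) (hb : ∀ i, 0 ≤ b i) :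
    |∏ i ∈ s, a i - ∏ i ∈ s, b i| ≤
      ∑ j ∈ s, |a j - b j| * ∏ i ∈ s.erase j, max (a i) (b i) := by
  induction s using Finset.induction_on with
  | empty => simp
  | insert x s hx ih =>
    rw [Finset.prod_insert hx, Finset.prod_insert hx, Finset.sum_insert hx,
      Finset.erase_insert hx]
    have hA : ∏ i ∈ s, a i ≤ ∏ i ∈ s, max (a i) (b i) :=
      Finset.prod_le_prod (fun i _ => ha i) fun i _ => le_max_left _ _
    have hA0 : 0 ≤ ∏ i ∈ s, a i := Finset.prod_nonneg fun i _ => ha i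
    have e : ∑ j ∈ s, |a j - b j| * ∏ i ∈ (insert x s).erase j, max (a i) (b i) =
        max (a x) (b x) * ∑ j ∈ s, |a j - b j| * ∏ i ∈ s.erase j, max (a i) (b i) := by
      rw [Finset.mul_sum]
      refine Finset.sum_congr rfl fun j hj => ?_
      have hxj : x ≠ j := fun h => hx (h ▸ hj)
      rw [Finset.erase_insert_of_ne hxj, Finset.prod_insert (by simp [hx])]
      ring
    rw [e]
    calc |a x * ∏ i ∈ s, a i - b x * ∏ i ∈ s, b i|
        = |(a x - b x) * ∏ i ∈ s, a i + b x * (∏ i ∈ s, a i - ∏ i ∈ s, b i)| := by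
          congr 1; ring
      _ ≤ |(a x - b x) * ∏ i ∈ s, a i| + |b x * (∏ i ∈ s, a i - ∏ i ∈ s, b i)| := abs_add_le _ _
      _ = |a x - b x| * ∏ i ∈ s, a i + b x * |∏ i ∈ s, a i - ∏ i ∈ s, b i| := by
          rw [abs_mul, abs_mul, abs_of_nonneg hA0, abs_of_nonneg (hb x)]
      _ ≤ _ := by
          refine add_le_add (mul_le_mul_of_nonneg_left hA (abs_nonneg _)) ?_
          exact mul_le_mul (le_max_right _ _) ih (abs_nonneg _) (le_max_of_le_left (ha x))

theorem prod_le_of_mem {ι : Type*} (s : Finset ι) {a : ι → ℝ}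
    (ha : ∀ i, 0 ≤ a i) (ha1 : ∀ i, a i ≤ 1) {j : ι} (hj : j ∈ s) : ∏ i ∈ s, a i ≤ a j := by
  classical
  rw [← Finset.mul_prod_erase s a hj]
  exact mul_le_of_le_one_right (ha j)
    (Finset.prod_le_one (fun i _ => ha i) fun i _ => ha1 i)

/-- In the telescoped difference, `∏ a ≤ a j` gives `1 - ∏ a ≥ 1 - a j`, and likewise for `b`. The
denominators are thus absorbed by the single coordinate `j`, turning `a j - b j` into a difference
of odds while the other coordinates keep their small product. -/
theorem abs_inv_one_sub_prod_sub_le {ι : Type*} [DecidableEq ι] (s : Finset ι) {a b : ι → ℝ}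
    (ha : ∀ i, 0 ≤ a i) (hb : ∀ i, 0 ≤ b i) (ha1 : ∀ i, a i < 1) (hb1 : ∀ i, b i < 1) :
    |(1 - ∏ i ∈ s, a i)⁻¹ - (1 - ∏ i ∈ s, b i)⁻¹| ≤
      ∑ j ∈ s, |odds (a j) - odds (b j)| * ∏ i ∈ s.erase j, max (a i) (b i) := by
  rcases s.eq_empty_or_nonempty with rfl | ⟨x, hx⟩
  · simp
  have hA : ∀ {j}, j ∈ s → _ := prod_le_of_mem s ha (fun i => (ha1 i).le)
  have hB : ∀ {j}, j ∈ s → _ := prod_le_of_mem s hb (fun i => (hb1 i).le)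
  have hsub := abs_prod_sub_prod_le s ha hb
  set A := ∏ i ∈ s, a i
  set B := ∏ i ∈ s, b i
  have hA1 : 0 < 1 - A := by linarith [hA hx, ha1 x]
  have hB1 : 0 < 1 - B := by linarith [hB hx, hb1 x]
  have e : (1 - A)⁻¹ - (1 - B)⁻¹ = (A - B) / ((1 - A) * (1 - B)) := by
    field_simp
    ring
  have hAB : 0 < (1 - A) * (1 - B) := mul_pos hA1 hB1
  rw [e, abs_div, abs_of_pos hAB]
  refine (div_le_div_of_nonneg_right hsub hAB.le).trans ?_
  rw [Finset.sum_div]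
  refine Finset.sum_le_sum fun j hj => ?_
  have h1 : 0 < (1 - a j) * (1 - b j) := mul_pos (by linarith [ha1 j]) (by linarith [hb1 j])
  have hle : (1 - a j) * (1 - b j) ≤ (1 - A) * (1 - B) :=
    mul_le_mul (by linarith [hA hj]) (by linarith [hB hj]) (by linarith [hb1 j]) hA1.le
  have hM : 0 ≤ ∏ i ∈ s.erase j, max (a i) (b i) :=
    Finset.prod_nonneg fun i _ => le_max_of_le_left (ha i)
  rw [odds_sub_odds (ha1 j) (hb1 j), abs_div, abs_of_pos h1, div_mul_eq_mul_div]
  exact div_le_div_of_nonneg_left (mul_nonneg (abs_nonneg _) hM) h1 hle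

/-- After Cauchy-Schwarz over the `n` summands, each term is a product of functions of single
entries, ready to be integrated by independence. -/
theorem sq_inv_one_sub_prod_sub_le (n : ℕ) {a b : ℕ → ℝ}
    (ha : ∀ i, 0 ≤ a i) (hb : ∀ i, 0 ≤ b i) (ha1 : ∀ i, a i < 1) (hb1 : ∀ i, b i < 1) :
    ((1 - ∏ i ∈ Finset.range n, a i)⁻¹ - (1 - ∏ i ∈ Finset.range n, b i)⁻¹) ^ 2 ≤
      n * ∑ j ∈ Finset.range n, ∏ i ∈ Finset.range n,
        if i = j then (odds (a i) - odds (b i)) ^ 2 else max (a i) (b i) ^ 2 := by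
  rw [← sq_abs]
  refine (pow_le_pow_left₀ (abs_nonneg _)
    (abs_inv_one_sub_prod_sub_le (Finset.range n) ha hb ha1 hb1) 2).trans ?_
  refine (sq_sum_le_card_mul_sum_sq).trans_eq ?_
  rw [Finset.card_range]
  congr 1
  refine Finset.sum_congr rfl fun j hj => ?_
  rw [← Finset.mul_prod_erase _ _ hj, if_pos rfl, mul_pow, sq_abs, ← Finset.prod_pow]
  congr 1
  refine Finset.prod_congr rfl fun i hi => ?_
  rw [if_neg (Finset.ne_of_mem_erase hi)]

/-- The factor `1 - ∏_{j < n} p(ζ_j)` of a row. -/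
def rowClause {E : Type*} (n : ℕ) (p : E → I) (ζ : ℕ → E) : ℝ :=
  1 - ∏ j ∈ Finset.range n, (p (ζ j) : ℝ)

theorem rowClause_mem {E : Type*} (n : ℕ) (p : E → I) (ζ : ℕ → E) : rowClause n p ζ ∈ I :=
  ⟨sub_nonneg.2 (Finset.prod_le_one (fun j _ => (p (ζ j)).2.1) fun j _ => (p (ζ j)).2.2),
    sub_le_self _ (Finset.prod_nonneg fun j _ => (p (ζ j)).2.1)⟩

theorem rowClause_zero {E : Type*} {n : ℕ} (hn : n ≠ 0) (ζ : ℕ → E) : rowClause n (fun _ => 0) ζ = 1 := by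
  simp [rowClause, hn]

section Rows

variable {E : Type*} [MeasurableSpace E] {ν : Measure E} [IsProbabilityMeasure ν] {p p' : E → I}

theorem measurable_rowClause (n : ℕ) (hp : Measurable p) : Measurable (rowClause n p) := by
  unfold rowClause
  exact measurable_const.sub (Finset.measurable_fun_prod _ fun j _ => by fun_prop)

theorem ae_row (h : ∀ᵐ e ∂ν, (p e : ℝ) < 1) : ∀ᵐ ζ ∂(rowLaw ν), ∀ j, (p (ζ j) : ℝ) < 1 := by
  rw [ae_all_iff]
  intro j
  exact (measurePreserving_eval_infinitePi (fun _ : ℕ => ν) j).quasiMeasurePreserving.ae h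

theorem integrable_row_bound (n : ℕ) (hp : Measurable p) (hp' : Measurable p')
    (h : MemLp (fun e => odds (p e)) 2 ν) (h' : MemLp (fun e => odds (p' e)) 2 ν) :
    Integrable (fun ζ => (n : ℝ) * ∑ j ∈ Finset.range n, ∏ i ∈ Finset.range n,
      if i = j then (odds (p (ζ i)) - odds (p' (ζ i))) ^ 2
        else max (p (ζ i) : ℝ) (p' (ζ i)) ^ 2) (rowLaw ν) ∧
    ∫ ζ, ((n : ℝ) * ∑ j ∈ Finset.range n, ∏ i ∈ Finset.range n,
      if i = j then (odds (p (ζ i)) - odds (p' (ζ i))) ^ 2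
        else max (p (ζ i) : ℝ) (p' (ζ i)) ^ 2) ∂(rowLaw ν) =
      (n : ℝ) ^ 2 * ((∫ e, (odds (p e) - odds (p' e)) ^ 2 ∂ν) *
        (∫ e, max (p e : ℝ) (p' e) ^ 2 ∂ν) ^ (n - 1)) := by
  have i1 : Integrable (fun e => (odds (p e) - odds (p' e)) ^ 2) ν := (h.sub h').integrable_sq
  have i2 : Integrable (fun e => max (p e : ℝ) (p' e) ^ 2) ν := by
    refine Integrable.of_bound (by fun_prop) 1 (Eventually.of_forall fun e => ?_)
    have h0 : 0 ≤ max (p e : ℝ) (p' e) := le_max_of_le_left (p e).2.1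
    rw [Real.norm_of_nonneg (by positivity)]
    exact pow_le_one₀ h0 (max_le (p e).2.2 (p' e).2.2)
  have hF : ∀ j i : ℕ, Integrable (fun e => if i = j then (odds (p e) - odds (p' e)) ^ 2
        else max (p e : ℝ) (p' e) ^ 2) ν := by
    intro j i
    split_ifs
    · exact i1
    · exact i2
  have hI : ∀ j, _ := fun j => integrable_prod_infinitePi (fun _ : ℕ => ν) (Finset.range n)
    fun i _ => hF j i
  have hE : ∀ j, _ := fun j => integral_prod_infinitePi (fun _ : ℕ => ν) (Finset.range n)
    fun i _ => hF j i
  refine ⟨(integrable_finsetSum _ fun j _ => hI j).const_mul _, ?_⟩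
  rw [integral_const_mul, integral_finsetSum _ fun j _ => hI j]
  have hv : ∀ j ∈ Finset.range n, ∫ ζ, (∏ i ∈ Finset.range n,
      if i = j then (odds (p (ζ i)) - odds (p' (ζ i))) ^ 2
        else max (p (ζ i) : ℝ) (p' (ζ i)) ^ 2) ∂(rowLaw ν) =
      (∫ e, (odds (p e) - odds (p' e)) ^ 2 ∂ν) *
        (∫ e, max (p e : ℝ) (p' e) ^ 2 ∂ν) ^ (n - 1) := by
    intro j hj
    rw [hE j, ← Finset.mul_prod_erase _ _ hj]
    simp only [if_true]
    congr 1
    rw [Finset.prod_congr rfl (g := fun _ => ∫ e, max (p e : ℝ) (p' e) ^ 2 ∂ν)]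
    · rw [Finset.prod_const, Finset.card_erase_of_mem hj, Finset.card_range]
    · intro i hi
      simp only [if_neg (Finset.ne_of_mem_erase hi)]
  rw [Finset.sum_congr rfl hv, Finset.sum_const, Finset.card_range, nsmul_eq_mul]
  ring

theorem ae_row_le (n : ℕ) (h : ∀ᵐ e ∂ν, (p e : ℝ) < 1) (h' : ∀ᵐ e ∂ν, (p' e : ℝ) < 1) :
    ∀ᵐ ζ ∂(rowLaw ν), ((rowClause n p ζ)⁻¹ - (rowClause n p' ζ)⁻¹) ^ 2 ≤
      (n : ℝ) * ∑ j ∈ Finset.range n, ∏ i ∈ Finset.range n,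
      if i = j then (odds (p (ζ i)) - odds (p' (ζ i))) ^ 2
        else max (p (ζ i) : ℝ) (p' (ζ i)) ^ 2 := by
  filter_upwards [ae_row h, ae_row h'] with ζ h h'
  exact sq_inv_one_sub_prod_sub_le n (fun i => (p (ζ i)).2.1) (fun i => (p' (ζ i)).2.1) h h'

theorem isClause_rowClause {n : ℕ} (hn : n ≠ 0) (hp : Measurable p)
    (hp1 : ∀ᵐ e ∂ν, (p e : ℝ) < 1) (h : MemLp (fun e => odds (p e)) 2 ν) :
    IsClause ν (rowClause n p) where
  meas := measurable_rowClause n hp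
  nonneg ζ := (rowClause_mem n p ζ).1
  le_one ζ := (rowClause_mem n p ζ).2
  pos := by
    filter_upwards [ae_row hp1] with ζ hζ
    have := prod_le_of_mem (Finset.range n) (a := fun j => (p (ζ j) : ℝ))
      (fun j => (p (ζ j)).2.1) (fun j => (p (ζ j)).2.2) (j := 0) (by simp; omega)
    unfold rowClause
    linarith [hζ 0]
  memLp := by
    -- Comparison with `p' = 0`, whose odds vanish and whose clause equals `1`.
    have h0 : MemLp (fun _ : E => odds ((0 : I) : ℝ)) 2 ν := memLp_const _
    have hb := (integrable_row_bound n hp measurable_const h h0).1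
    have hle := ae_row_le n hp1 (p' := fun _ => (0 : I)) (Eventually.of_forall fun _ => by simp)
    have hm : Measurable fun ζ => (rowClause n p ζ)⁻¹ - 1 :=
      (measurable_rowClause n hp).inv.sub measurable_const
    have : MemLp (fun ζ => (rowClause n p ζ)⁻¹ - 1) 2 (rowLaw ν) := by
      rw [memLp_two_iff_integrable_sq hm.aestronglyMeasurable]
      refine hb.mono' (hm.pow_const 2).aestronglyMeasurable ?_
      filter_upwards [hle] with ζ hζ
      rw [rowClause_zero hn, inv_one] at hζ
      rwa [Real.norm_of_nonneg (sq_nonneg _)]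
    refine (this.add (memLp_const 1)).congr_norm
      (measurable_rowClause n hp).inv.aestronglyMeasurable (Eventually.of_forall fun ζ => ?_)
    simp

theorem integral_inv_rowClause_sub_sq_le {n : ℕ} (hn : n ≠ 0) (hp : Measurable p)
    (hp' : Measurable p') (hp1 : ∀ᵐ e ∂ν, (p e : ℝ) < 1) (hp1' : ∀ᵐ e ∂ν, (p' e : ℝ) < 1)
    (h : MemLp (fun e => odds (p e)) 2 ν) (h' : MemLp (fun e => odds (p' e)) 2 ν) :
    ∫ ζ, ((rowClause n p ζ)⁻¹ - (rowClause n p' ζ)⁻¹) ^ 2 ∂(rowLaw ν) ≤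
      (n : ℝ) ^ 2 * ((∫ e, (odds (p e) - odds (p' e)) ^ 2 ∂ν) *
        (∫ e, max (p e : ℝ) (p' e) ^ 2 ∂ν) ^ (n - 1)) := by
  have hb := integrable_row_bound n hp hp' h h'
  rw [← hb.2]
  exact integral_mono_ae ((isClause_rowClause hn hp hp1 h).memLp.sub
    (isClause_rowClause hn hp' hp1' h').memLp).integrable_sq hb.1 (ae_row_le n hp1 hp1')

theorem integral_inv_rowClause_sub_one_sq_le {n : ℕ} (hn : n ≠ 0) (hp : Measurable p)
    (hp1 : ∀ᵐ e ∂ν, (p e : ℝ) < 1) (h : MemLp (fun e => odds (p e)) 2 ν) :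
    ∫ ζ, ((rowClause n p ζ)⁻¹ - 1) ^ 2 ∂(rowLaw ν) ≤
      (n : ℝ) ^ 2 * ((∫ e, odds (p e) ^ 2 ∂ν) * (∫ e, (p e : ℝ) ^ 2 ∂ν) ^ (n - 1)) := by
  have := integral_inv_rowClause_sub_sq_le (ν := ν) hn hp (p' := fun _ => (0 : I))
    measurable_const hp1 (Eventually.of_forall fun _ => by simp) h (memLp_const _)
  simp only [rowClause_zero hn, inv_one] at this
  refine this.trans_eq ?_
  have e : ∀ e : E, max (p e : ℝ) 0 = p e := fun e => max_eq_left (p e).2.1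
  simp [odds, e]

theorem integral_rowClause (n : ℕ) (hp : Measurable p) :
    ∫ ζ, rowClause n p ζ ∂(rowLaw ν) = 1 - (∫ e, (p e : ℝ) ∂ν) ^ n := by
  have hi : Integrable (fun e => (p e : ℝ)) ν :=
    Integrable.of_bound (by fun_prop) 1 (Eventually.of_forall fun e => by
      rw [Real.norm_of_nonneg (p e).2.1]; exact (p e).2.2)
  have h1 := integrable_prod_infinitePi (fun _ : ℕ => ν) (Finset.range n) fun _ _ => hi
  have h2 := integral_prod_infinitePi (fun _ : ℕ => ν) (Finset.range n) fun _ _ => hi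
  unfold rowClause
  rw [integral_sub (integrable_const _) h1, h2]
  simp

/-! ### The invariant and its consequences for clauses -/

/-- The invariant of the recursion: the odds of `p` are close to `1` in `L²`. -/
structure IsGood (k : ℕ) (ν : Measure E) (p : E → I) : Prop where
  meas : Measurable p
  lt_one : ∀ᵐ e ∂ν, (p e : ℝ) < 1
  memLp : MemLp (fun e => odds (p e)) 2 ν
  dev : ∫ e, (odds (p e) - 1) ^ 2 ∂ν ≤ 1 / (4 * (k : ℝ) ^ 2)

theorem IsGood.memLp_sub_one {k : ℕ} (h : IsGood k ν p) :
    MemLp (fun e => odds (p e) - 1) 2 ν := h.memLp.sub (memLp_const 1)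

/-- With `y` the odds, `a ≤ (2 + (y - 1)) / 4`. Squaring with a Young inequality of weight `k`
leaves a relative error `O(1/k)`, which costs only a constant once raised to the power `k - 2`. -/
theorem IsGood.integral_max_sq_le {k : ℕ} (hk : 1 ≤ k) (h : IsGood k ν p) (h' : IsGood k ν p') :
    ∫ e, max (p e : ℝ) (p' e) ^ 2 ∂ν ≤ (1 + 2 / k) / 4 := by
  have hk' : (1 : ℝ) ≤ k := by exact_mod_cast hk
  have i1 := h.memLp_sub_one.integrable_sq
  have i2 := h'.memLp_sub_one.integrable_sq
  have i3 : Integrable (fun e => (1 + k : ℝ) / 16 * ((odds (p e) - 1) ^ 2 + (odds (p' e) - 1) ^ 2))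
    ν := (i1.add i2).const_mul _
  have i4 : Integrable (fun e => (4 + 4 / k : ℝ) / 16 +
      (1 + k : ℝ) / 16 * ((odds (p e) - 1) ^ 2 + (odds (p' e) - 1) ^ 2)) ν :=
    (integrable_const _).add i3
  have key : ∀ y : ℝ, (2 + (y - 1)) ^ 2 ≤ (4 + 4 / k) + (1 + k) * (y - 1) ^ 2 := by
    intro y
    have e : (4 + 4 / k) + (1 + k) * (y - 1) ^ 2 - (2 + (y - 1)) ^ 2
        = (k * (y - 1) - 2) ^ 2 / k := by
      field_simp; ring
    have : 0 ≤ (k * (y - 1) - 2) ^ 2 / k := by positivity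
    linarith
  have bound : ∀ a : ℝ, 0 ≤ a → a < 1 → a ^ 2 ≤
      (4 + 4 / k : ℝ) / 16 + (1 + k : ℝ) / 16 * (odds a - 1) ^ 2 := by
    intro a h0 h1
    have := pow_le_pow_left₀ h0 (le_one_add_odds_div h1) 2
    have h2 := key (odds a)
    calc a ^ 2 ≤ ((1 + odds a) / 4) ^ 2 := this
      _ = (2 + (odds a - 1)) ^ 2 / 16 := by ring
      _ ≤ ((4 + 4 / k) + (1 + k) * (odds a - 1) ^ 2) / 16 := by gcongr
      _ = _ := by ring
  have hle : ∫ e, max (p e : ℝ) (p' e) ^ 2 ∂ν ≤ ∫ e, ((4 + 4 / k : ℝ) / 16 +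
      (1 + k : ℝ) / 16 * ((odds (p e) - 1) ^ 2 + (odds (p' e) - 1) ^ 2)) ∂ν := by
    refine integral_mono_of_nonneg (Eventually.of_forall fun e => sq_nonneg _) i4 ?_
    filter_upwards [h.lt_one, h'.lt_one] with e h1 h2
    have a1 : 0 ≤ (1 + k : ℝ) / 16 * (odds (p e) - 1) ^ 2 := by positivity
    have a2 : 0 ≤ (1 + k : ℝ) / 16 * (odds (p' e) - 1) ^ 2 := by positivity
    rcases max_choice (p e : ℝ) (p' e) with hm | hm <;> rw [hm]
    · linarith [bound _ (p e).2.1 h1]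
    · linarith [bound _ (p' e).2.1 h2]
  refine hle.trans ?_
  rw [integral_add (integrable_const _) i3, integral_const_mul, integral_add i1 i2]
  simp only [integral_const, probReal_univ, one_smul]
  have hd : (1 + k : ℝ) / 16 * (∫ e, (odds (p e) - 1) ^ 2 ∂ν + ∫ e, (odds (p' e) - 1) ^ 2 ∂ν) ≤
      (2 * k : ℝ) / 16 * (1 / (4 * (k : ℝ) ^ 2) + 1 / (4 * (k : ℝ) ^ 2)) := by
    have := h.dev
    have := h'.dev
    have : 0 ≤ ∫ e, (odds (p e) - 1) ^ 2 ∂ν := integral_nonneg fun _ => sq_nonneg _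
    have : 0 ≤ ∫ e, (odds (p' e) - 1) ^ 2 ∂ν := integral_nonneg fun _ => sq_nonneg _
    gcongr
    linarith
  have e : (2 * k : ℝ) / 16 * (1 / (4 * (k : ℝ) ^ 2) + 1 / (4 * (k : ℝ) ^ 2)) = 1 / (16 * k) := by
    field_simp; ring
  have e2 : (1 + 2 / k : ℝ) / 4 - (4 + 4 / k) / 16 - 1 / (16 * k) = 3 / (16 * k) := by
    field_simp; ring
  have : (0 : ℝ) ≤ 3 / (16 * k) := by positivity
  linarith

theorem IsGood.integral_odds_sq_le {k : ℕ} (hk : 1 ≤ k) (h : IsGood k ν p) :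
    ∫ e, odds (p e) ^ 2 ∂ν ≤ 4 := by
  have hk' : (1 : ℝ) ≤ k := by exact_mod_cast hk
  have h2 := integral_add_sq_le h.memLp_sub_one (memLp_const (1 : ℝ))
  simp only [sub_add_cancel, one_pow, integral_const, probReal_univ, one_smul] at h2
  have : 1 / (4 * (k : ℝ) ^ 2) ≤ 1 := by
    rw [div_le_one (by positivity)]; nlinarith
  linarith [h.dev]

theorem IsGood.le_integral {k : ℕ} (hk : 1 ≤ k) (h : IsGood k ν p) :
    (1 - 1 / (2 * k)) / 2 ≤ ∫ e, (p e : ℝ) ∂ν := by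
  have hk' : (1 : ℝ) ≤ k := by exact_mod_cast hk
  have i1 := h.memLp_sub_one.integrable_sq
  have i2 : Integrable (fun e => (k : ℝ) / 2 * (odds (p e) - 1) ^ 2) ν := i1.const_mul _
  have hi : Integrable (fun e => (p e : ℝ)) ν :=
    Integrable.of_bound (h.meas.subtype_val.aestronglyMeasurable) 1
      (Eventually.of_forall fun e => by
        rw [Real.norm_of_nonneg (p e).2.1]; exact (p e).2.2)
  have hle : ∫ e, ((1 / 2 - 1 / (8 * k) : ℝ) - (k : ℝ) / 2 * (odds (p e) - 1) ^ 2) ∂ν ≤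
      ∫ e, (p e : ℝ) ∂ν := by
    refine integral_mono_ae ((integrable_const _).sub i2) hi ?_
    filter_upwards [h.lt_one] with e h1
    refine le_trans ?_ (half_sub_odds_le (p e).2.1 h1)
    -- Young's inequality `|u| / 2 ≤ 1 / (8k) + k u² / 2`, with the weight chosen to balance the
    -- bound `1 / (4k²)` on `∫ u²`.
    have e1 : 1 / (8 * k : ℝ) + (k : ℝ) / 2 * (odds (p e) - 1) ^ 2 - |odds (p e) - 1| / 2
        = (2 * k * |odds (p e) - 1| - 1) ^ 2 / (8 * k) := by
      rw [← sq_abs (odds (p e) - 1)]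
      field_simp; ring
    have : 0 ≤ (2 * k * |odds (p e) - 1| - 1) ^ 2 / (8 * k : ℝ) := by positivity
    linarith
  rw [integral_sub (integrable_const _) i2, integral_const_mul] at hle
  simp only [integral_const, probReal_univ, one_smul] at hle
  have hd : (k : ℝ) / 2 * ∫ e, (odds (p e) - 1) ^ 2 ∂ν ≤ (k : ℝ) / 2 * (1 / (4 * (k : ℝ) ^ 2)) :=
    mul_le_mul_of_nonneg_left h.dev (by positivity)
  have e : (k : ℝ) / 2 * (1 / (4 * (k : ℝ) ^ 2)) = 1 / (8 * k) := by field_simp; norm_num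
  have e2 : (1 - 1 / (2 * k)) / 2 = (1 / 2 - 1 / (8 * k) : ℝ) - 1 / (8 * k) := by
    field_simp; ring
  linarith

theorem IsGood.le_one_sub_integral_rowClause {k : ℕ} (hk : 1 ≤ k) (h : IsGood k ν p) :
    1 / 2 ^ k ≤ 1 - ∫ ζ, rowClause (k - 1) p ζ ∂(rowLaw ν) := by
  rw [integral_rowClause _ h.meas, sub_sub_cancel]
  have hk' : (1 : ℝ) ≤ k := by exact_mod_cast hk
  have h1 : 1 / (2 * k : ℝ) ≤ 1 / 2 := by
    rw [div_le_div_iff₀ (by positivity) (by norm_num)]; linarith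
  -- Bernoulli: the relative error `1 / (2k)` loses at most a factor `2` over `k - 1` entries.
  have h3 := one_add_mul_le_pow (a := -(1 / (2 * k : ℝ))) (by linarith) (k - 1)
  have h4 : ((k - 1 : ℕ) : ℝ) * (1 / (2 * k : ℝ)) ≤ 1 / 2 := by
    rw [Nat.cast_sub hk, Nat.cast_one, mul_one_div, div_le_div_iff₀ (by positivity) (by norm_num)]
    linarith
  calc (1 : ℝ) / 2 ^ k = (1 / 2) * (1 / 2) ^ (k - 1) := by
        rw [← pow_succ', Nat.sub_add_cancel hk, one_div_pow]
    _ ≤ (1 + -(1 / (2 * k : ℝ))) ^ (k - 1) * (1 / 2) ^ (k - 1) := by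
        gcongr
        linarith
    _ = ((1 - 1 / (2 * k)) / 2) ^ (k - 1) := by rw [← mul_pow]; congr 1; ring
    _ ≤ _ := pow_le_pow_left₀ (by linarith) (h.le_integral hk) _

end Rows

/-! ### One step of the recursion: invariance and contraction -/

/-- The image of an array of points of `E` under the recursion, where the entries of the array are
read through `p`. -/
def recThrough {E : Type*} (k : ℕ) (p : E → I) (ω : (ℕ × ℕ) × (Bool × ℕ × ℕ → E)) : I :=
  recMap k (ω.1, fun x => p (ω.2 x))

/-- Here `1 - R = M / (P + M - P M)`, so the common denominator cancels in the odds. -/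
theorem odds_recursion {P M : ℝ} (hP : 0 < P) (hM : 0 < M) (hM1 : M ≤ 1) :
    (1 - M) * P / (P + M - P * M) < 1 ∧ odds ((1 - M) * P / (P + M - P * M)) = P * M⁻¹ - P := by
  have hden : 0 < P + M - P * M := by nlinarith
  have e : 1 - (1 - M) * P / (P + M - P * M) = M / (P + M - P * M) := by
    rw [one_sub_div hden.ne']
    congr 1
    ring
  have hpos : 0 < M / (P + M - P * M) := div_pos hM hden
  refine ⟨by linarith, ?_⟩
  unfold odds
  rw [e, div_div_div_cancel_right₀ hden.ne']
  field_simp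

/-- The numerical inequalities between `k` and the Poisson mean `r` used in the contraction
argument. -/
structure NumericBounds (k : ℕ) (r : ℝ) : Prop where
  two_le : 2 ≤ k
  small : r * ((k : ℝ) ^ 2 * (4 * ((1 + 2 / k) / 4) ^ (k - 2))) ≤ 1 / 16
  step : 12 * (r * ((k : ℝ) ^ 2 * (4 * ((1 + 2 / k) / 4) ^ (k - 2)))) +
    2 * Real.exp (-(k / 4 : ℝ)) ≤ 1 / (4 * (k : ℝ) ^ 2)
  contraction : (12 * r + 2 * Real.exp (-(k / 4 : ℝ)) * (r ^ 2 + r)) *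
    ((k : ℝ) ^ 2 * ((1 + 2 / k) / 4) ^ (k - 2)) ≤ 1 / 2
  lower : (k / 4 : ℝ) ≤ r * (1 / 2 ^ k)

section Step

variable {E : Type*} [MeasurableSpace E] {ν : Measure E} [IsProbabilityMeasure ν] {p p' : E → I}
  {k : ℕ} {r : ℝ≥0}

theorem measurable_recThrough (k : ℕ) (hp : Measurable p) : Measurable (recThrough k p) :=
  (measurable_recMap k).comp (by fun_prop)

theorem ae_array (r : ℝ≥0) (h : ∀ᵐ e ∂ν, (p e : ℝ) < 1) :
    ∀ᵐ ω ∂(arrayLaw r ν), ∀ x, (p (ω.2 x) : ℝ) < 1 := by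
  have h1 : ∀ᵐ η ∂(Measure.infinitePi fun _ : Bool × ℕ × ℕ => ν), ∀ x, (p (η x) : ℝ) < 1 := by
    rw [ae_all_iff]
    intro x
    exact (measurePreserving_eval_infinitePi (fun _ => ν) x).quasiMeasurePreserving.ae h
  exact Measure.quasiMeasurePreserving_snd.ae h1

theorem clauseProd_pos (hk : 2 ≤ k) (s : Bool) (d : ℕ) {η : EtaArray}
    (h : ∀ x, (η x : ℝ) < 1) : 0 < clauseProd k s d η := by
  refine Finset.prod_pos fun i _ => ?_
  have := prod_le_of_mem (Finset.range (k - 1)) (a := fun j => (η (s, i, j) : ℝ))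
    (fun j => (η (s, i, j)).2.1) (fun j => (η (s, i, j)).2.2) (j := 0) (by simp; omega)
  linarith [h (s, i, 0)]

theorem ae_recThrough (hk : 2 ≤ k) (r : ℝ≥0) (h : ∀ᵐ e ∂ν, (p e : ℝ) < 1) :
    ∀ᵐ ω ∂(arrayLaw r ν), (recThrough k p ω : ℝ) < 1 ∧
      odds (recThrough k p ω) = ratio (rowClause (k - 1) p) ω - numer (rowClause (k - 1) p) ω := by
  filter_upwards [ae_array r h] with ω hω
  have hP := clauseProd_pos hk true ω.1.1 (η := fun x => p (ω.2 x)) hω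
  have hM := clauseProd_pos hk false ω.1.2 (η := fun x => p (ω.2 x)) hω
  obtain ⟨h1, h2⟩ := odds_recursion hP hM (clauseProd_mem _ _ _ _).2
  refine ⟨h1, h2.trans ?_⟩
  simp only [ratio, numer, rowProd, rowClause, clauseProd, Finset.prod_const_one, mul_one,
    Finset.prod_inv_distrib]

theorem IsGood.isClause (hk : 2 ≤ k) (h : IsGood k ν p) : IsClause ν (rowClause (k - 1) p) :=
  isClause_rowClause (by omega) h.meas h.lt_one h.memLp

theorem IsGood.integral_inv_clause_sub_sq_le (hk : 2 ≤ k) (h : IsGood k ν p)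
    (h' : IsGood k ν p') :
    ∫ ζ, ((rowClause (k - 1) p ζ)⁻¹ - (rowClause (k - 1) p' ζ)⁻¹) ^ 2 ∂(rowLaw ν) ≤
      (k : ℝ) ^ 2 * ((1 + 2 / k) / 4) ^ (k - 2) * ∫ e, (odds (p e) - odds (p' e)) ^ 2 ∂ν := by
  refine (integral_inv_rowClause_sub_sq_le (by omega) h.meas h'.meas h.lt_one h'.lt_one
    h.memLp h'.memLp).trans ?_
  have hq := h.integral_max_sq_le (by omega) h'
  have hq0 : 0 ≤ ∫ e, max (p e : ℝ) (p' e) ^ 2 ∂ν := integral_nonneg fun _ => sq_nonneg _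
  have hD : 0 ≤ ∫ e, (odds (p e) - odds (p' e)) ^ 2 ∂ν := integral_nonneg fun _ => sq_nonneg _
  have hn : ((k - 1 : ℕ) : ℝ) ≤ k := by exact_mod_cast Nat.sub_le k 1
  rw [show k - 1 - 1 = k - 2 by omega]
  calc _ ≤ (k : ℝ) ^ 2 * ((∫ e, (odds (p e) - odds (p' e)) ^ 2 ∂ν) *
        ((1 + 2 / k) / 4) ^ (k - 2)) := by gcongr
    _ = _ := by ring

theorem IsGood.integral_inv_clause_sub_one_sq_le (hk : 2 ≤ k) (h : IsGood k ν p) :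
    ∫ ζ, ((rowClause (k - 1) p ζ)⁻¹ - 1) ^ 2 ∂(rowLaw ν) ≤
      (k : ℝ) ^ 2 * (4 * ((1 + 2 / k) / 4) ^ (k - 2)) := by
  refine (integral_inv_rowClause_sub_one_sq_le (by omega) h.meas h.lt_one h.memLp).trans ?_
  have hq := h.integral_max_sq_le (by omega) h
  simp only [max_self] at hq
  have hq0 : 0 ≤ ∫ e, (p e : ℝ) ^ 2 ∂ν := integral_nonneg fun _ => sq_nonneg _
  have hD : 0 ≤ ∫ e, odds (p e) ^ 2 ∂ν := integral_nonneg fun _ => sq_nonneg _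
  have hD4 := h.integral_odds_sq_le (by omega)
  have hn : ((k - 1 : ℕ) : ℝ) ≤ k := by exact_mod_cast Nat.sub_le k 1
  rw [show k - 1 - 1 = k - 2 by omega]
  gcongr

theorem IsGood.le_mul_one_sub (hb : NumericBounds k r) (h : IsGood k ν p) :
    (k / 4 : ℝ) ≤ r * (1 - ∫ ζ, rowClause (k - 1) p ζ ∂(rowLaw ν)) :=
  hb.lower.trans (mul_le_mul_of_nonneg_left
    (h.le_one_sub_integral_rowClause (by have := hb.two_le; omega)) r.2)

/-- The recursion preserves the invariant. -/
theorem IsGood.recThrough (hb : NumericBounds k r) (h : IsGood k ν p) :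
    IsGood k (arrayLaw r ν) (recThrough k p) := by
  have hk := hb.two_le
  have hc := h.isClause hk
  have hae := ae_recThrough hk r h.lt_one
  have hodds : (fun ω => odds (KSat.recThrough k p ω)) =ᵐ[arrayLaw r ν]
      fun ω => ratio (rowClause (k - 1) p) ω - numer (rowClause (k - 1) p) ω :=
    hae.mono fun ω hω => hω.2
  have mR := memLp_ratio r hc
  have mN := memLp_numer r hc
  refine ⟨measurable_recThrough k h.meas, hae.mono fun ω hω => hω.1,
    (memLp_congr_ae hodds).2 (mR.sub mN), ?_⟩
  have h1 : MemLp (fun ω => ratio (rowClause (k - 1) p) ω - 1) 2 (arrayLaw r ν) :=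
    mR.sub (memLp_const 1)
  have h2 : MemLp (fun ω => -numer (rowClause (k - 1) p) ω) 2 (arrayLaw r ν) := mN.neg
  have e : ∫ ω, (odds (KSat.recThrough k p ω) - 1) ^ 2 ∂(arrayLaw r ν) =
      ∫ ω, ((ratio (rowClause (k - 1) p) ω - 1) + -numer (rowClause (k - 1) p) ω) ^ 2
        ∂(arrayLaw r ν) := by
    refine integral_congr_ae (hodds.mono fun ω hω => ?_)
    dsimp only at hω ⊢
    rw [hω]; ring
  rw [e]
  refine (integral_add_sq_le h1 h2).trans (le_trans ?_ hb.step)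
  have hS := mul_le_mul_of_nonneg_left (h.integral_inv_clause_sub_one_sq_le hk) (NNReal.coe_nonneg r)
  -- The constant clause `1` has ratio `1`, so the difference estimate bounds the deviation of the
  -- ratio from `1`.
  have hA := integral_ratio_sub_sq_le r hc IsClause.one (hS.trans hb.small) (by simp)
  have hone : ∀ ω : (ℕ × ℕ) × (Bool × ℕ × ℕ → E), ratio (fun _ => 1) ω = 1 := fun ω => by
    simp [ratio, rowProd]
  simp only [hone, inv_one] at hA
  have hN := integral_numer_sq_le r hc (h.le_mul_one_sub hb)
  simp only [neg_sq]
  linarith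

/-- The recursion contracts the `L²` distance of the odds of a coupling. -/
theorem IsGood.integral_recThrough_sub_sq_le (hb : NumericBounds k r) (h : IsGood k ν p)
    (h' : IsGood k ν p') :
    ∫ ω, (odds (KSat.recThrough k p ω) - odds (KSat.recThrough k p' ω)) ^ 2 ∂(arrayLaw r ν) ≤
      1 / 2 * ∫ e, (odds (p e) - odds (p' e)) ^ 2 ∂ν := by
  have hk := hb.two_le
  have hr : (0 : ℝ) ≤ r := NNReal.coe_nonneg r
  have hc := h.isClause hk
  have hc' := h'.isClause hk
  have h1 : MemLp (fun ω => ratio (rowClause (k - 1) p) ω - ratio (rowClause (k - 1) p') ω) 2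
    (arrayLaw r ν) := (memLp_ratio r hc).sub (memLp_ratio r hc')
  have h2 : MemLp (fun ω => -(numer (rowClause (k - 1) p) ω - numer (rowClause (k - 1) p') ω)) 2
    (arrayLaw r ν) := ((memLp_numer r hc).sub (memLp_numer r hc')).neg
  have e : ∫ ω, (odds (KSat.recThrough k p ω) - odds (KSat.recThrough k p' ω)) ^ 2
        ∂(arrayLaw r ν) =
      ∫ ω, ((ratio (rowClause (k - 1) p) ω - ratio (rowClause (k - 1) p') ω) +
        -(numer (rowClause (k - 1) p) ω - numer (rowClause (k - 1) p') ω)) ^ 2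
        ∂(arrayLaw r ν) := by
    refine integral_congr_ae ?_
    filter_upwards [ae_recThrough hk r h.lt_one, ae_recThrough hk r h'.lt_one] with ω hω hω'
    rw [hω.2, hω'.2]; ring
  rw [e]
  refine (integral_add_sq_le h1 h2).trans ?_
  have hS := mul_le_mul_of_nonneg_left (h.integral_inv_clause_sub_one_sq_le hk) (NNReal.coe_nonneg r)
  have hS' := mul_le_mul_of_nonneg_left (h'.integral_inv_clause_sub_one_sq_le hk) (NNReal.coe_nonneg r)
  have hA := integral_ratio_sub_sq_le r hc hc' (hS.trans hb.small) (hS'.trans hb.small)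
  have hN := integral_numer_sub_sq_le r hc hc' (h.le_mul_one_sub hb) (h'.le_mul_one_sub hb)
  have hΔ := h.integral_inv_clause_sub_sq_le hk h'
  have hD : 0 ≤ ∫ e, (odds (p e) - odds (p' e)) ^ 2 ∂ν := integral_nonneg fun _ => sq_nonneg _
  simp only [neg_sq]
  have hcoef : 0 ≤ 12 * (r : ℝ) + 2 * Real.exp (-(k / 4 : ℝ)) * ((r : ℝ) ^ 2 + r) := by positivity
  have h3 := mul_le_mul_of_nonneg_left hΔ hcoef
  have h4 := mul_le_mul_of_nonneg_right hb.contraction hD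
  nlinarith

end Step

/-! ### Numerical inequalities for large `k` -/

theorem one_add_two_div_pow_le {k : ℕ} (hk : 2 ≤ k) :
    ((1 + 2 / k : ℝ) / 4) ^ (k - 2) ≤ 128 / 4 ^ k := by
  have hk0 : (0 : ℝ) < k := by exact_mod_cast (by omega : 0 < k)
  have h1 : (1 + 2 / k : ℝ) ^ (k - 2) ≤ 8 := by
    have h2 : (1 + 2 / k : ℝ) ≤ Real.exp (2 / k) := by
      linarith [Real.add_one_le_exp (2 / k : ℝ)]
    have h3 : ((k - 2 : ℕ) : ℝ) * (2 / k) ≤ 2 := by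
      rw [Nat.cast_sub hk, mul_div_assoc', div_le_iff₀ hk0]
      push_cast
      linarith
    have h4 : Real.exp 2 ≤ 8 := by
      have h5 := Real.exp_one_lt_d9
      have h6 : Real.exp 2 = Real.exp 1 ^ 2 := by
        rw [← Real.exp_nat_mul]; norm_num
      rw [h6]
      nlinarith [Real.exp_pos 1]
    calc (1 + 2 / k : ℝ) ^ (k - 2) ≤ Real.exp (2 / k) ^ (k - 2) :=
          pow_le_pow_left₀ (by positivity) h2 _
      _ = Real.exp (((k - 2 : ℕ) : ℝ) * (2 / k)) := by rw [Real.exp_nat_mul]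
      _ ≤ Real.exp 2 := Real.exp_le_exp.2 h3
      _ ≤ 8 := h4
  have h4 : (4 : ℝ) ^ k = 16 * 4 ^ (k - 2) := by
    obtain ⟨m, rfl⟩ := Nat.exists_eq_add_of_le hk
    rw [pow_add, Nat.add_sub_cancel_left]; norm_num
  rw [div_pow, h4, div_le_div_iff₀ (by positivity) (by positivity)]
  have : (0 : ℝ) < 4 ^ (k - 2) := by positivity
  nlinarith

/-- With `t = 2⁻ᵏ` one has `r ≤ k 2ᵏ / 2` and `q ≤ 128 t²`, hence `r q = O(k t)` and `r² q = O(k²)`.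
The latter occurs only multiplied by `exp(-k/4)`, so every left side to be made small tends to `0`
fast enough. -/
theorem eventually_numericBounds :
    ∀ᶠ k : ℕ in atTop, ∀ α : ℝ≥0, (2 : ℝ) ^ k * Real.log 2 - 2 ≤ (α : ℝ) →
      (α : ℝ) ≤ (2 : ℝ) ^ k * Real.log 2 → NumericBounds k (α * k / 2 : ℝ≥0) := by
  have t2 : ∀ m : ℕ, Tendsto (fun k : ℕ => (k : ℝ) ^ m * (1 / 2 : ℝ) ^ k) atTop (𝓝 0) := fun m =>
    tendsto_pow_const_mul_const_pow_of_abs_lt_one m (by norm_num [abs_of_pos])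
  have te : ∀ m : ℕ, Tendsto (fun k : ℕ => (k : ℝ) ^ m * Real.exp (-(1 / 4)) ^ k) atTop (𝓝 0) :=
    fun m => tendsto_pow_const_mul_const_pow_of_abs_lt_one m (by
      rw [abs_of_pos (Real.exp_pos _)]; exact Real.exp_lt_one_iff.2 (by norm_num))
  have ev2 := fun (m : ℕ) (ε : ℝ) (hε : 0 < ε) => (t2 m).eventually (gt_mem_nhds hε)
  have eve := fun (m : ℕ) (ε : ℝ) (hε : 0 < ε) => (te m).eventually (gt_mem_nhds hε)
  filter_upwards [ev2 5 (1 / 100000) (by norm_num), eve 4 (1 / 100000) (by norm_num),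
    eventually_ge_atTop 8] with k h5 h4 hk8 α hα1 hα2
  have hk : (8 : ℝ) ≤ k := by exact_mod_cast hk8
  have hlog1 := Real.log_two_lt_d9
  have hlog2 := Real.log_two_gt_d9
  have h2k : (0 : ℝ) < 2 ^ k := by positivity
  -- Makes `2 ^ k` large enough to absorb the `- 2` in the lower bound on `α`, giving `α ≥ 2 ^ k /
  -- 2`.
  have h256 : (256 : ℝ) ≤ 2 ^ k := by
    calc (256 : ℝ) = 2 ^ 8 := by norm_num
      _ ≤ _ := pow_le_pow_right₀ (by norm_num) hk8
  have hcast : ((α * k / 2 : ℝ≥0) : ℝ) = (α : ℝ) * k / 2 := by push_cast; ring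
  rw [hcast]
  have hα0 : (0 : ℝ) ≤ α := α.2
  have hαu : (α : ℝ) ≤ 2 ^ k := by nlinarith
  have hαl : (2 : ℝ) ^ k / 2 ≤ α := by nlinarith
  set r : ℝ := (α : ℝ) * k / 2 with hr
  have hr0 : 0 ≤ r := by positivity
  have hru : r ≤ k * 2 ^ k / 2 := by rw [hr]; nlinarith
  have hq := one_add_two_div_pow_le (by omega : 2 ≤ k)
  set q : ℝ := ((1 + 2 / k : ℝ) / 4) ^ (k - 2) with hqd
  have hq0 : 0 ≤ q := by positivity
  have h4k : (4 : ℝ) ^ k = 2 ^ k * 2 ^ k := by rw [← mul_pow]; norm_num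
  set t : ℝ := (1 / 2 : ℝ) ^ k with ht
  have ht0 : 0 < t := by positivity
  have htk : t * 2 ^ k = 1 := by rw [ht, ← mul_pow]; norm_num
  have hqt : q ≤ 128 * t ^ 2 := by
    refine hq.trans_eq ?_
    rw [h4k, div_eq_iff (by positivity)]
    linear_combination (-128 * (t * 2 ^ k + 1)) * htk
  have hrq : r * q ≤ 64 * (k * t) := by
    calc r * q ≤ (k * 2 ^ k / 2) * (128 * t ^ 2) := by gcongr
      _ = 64 * (k * t) * (t * 2 ^ k) := by ring
      _ = _ := by rw [htk, mul_one]
  have hrrq : r ^ 2 * q ≤ 32 * k ^ 2 := by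
    calc r ^ 2 * q ≤ (k * 2 ^ k / 2) ^ 2 * (128 * t ^ 2) := by gcongr
      _ = 32 * k ^ 2 * (t * 2 ^ k) ^ 2 := by ring
      _ = _ := by rw [htk]; ring
  have he : Real.exp (-(k / 4 : ℝ)) = Real.exp (-(1 / 4)) ^ k := by
    rw [← Real.exp_nat_mul]; congr 1; ring
  set x : ℝ := Real.exp (-(1 / 4)) ^ k with hx
  have hx0 : 0 < x := by positivity
  have hx1 : x ≤ 1 := pow_le_one₀ (Real.exp_nonneg _) (Real.exp_le_one_iff.2 (by norm_num))
  have hk1 : (1 : ℝ) ≤ k ^ 2 := one_le_pow₀ (by linarith)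
  have h3 : (k : ℝ) ^ 3 * t ≤ k ^ 5 * t :=
    mul_le_mul_of_nonneg_right (pow_le_pow_right₀ (by linarith) (by norm_num)) ht0.le
  have hx2 : (k : ℝ) ^ 2 * x ≤ k ^ 4 * x :=
    mul_le_mul_of_nonneg_right (pow_le_pow_right₀ (by linarith) (by norm_num)) hx0.le
  have hrW : r * ((k : ℝ) ^ 2 * (4 * q)) ≤ 256 * (k ^ 3 * t) := by
    calc r * ((k : ℝ) ^ 2 * (4 * q)) = 4 * k ^ 2 * (r * q) := by ring
      _ ≤ 4 * k ^ 2 * (64 * (k * t)) := by gcongr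
      _ = _ := by ring
  refine ⟨by omega, by linarith, ?_, ?_, ?_⟩
  · rw [he, le_div_iff₀ (by positivity)]
    calc (12 * (r * ((k : ℝ) ^ 2 * (4 * q))) + 2 * x) * (4 * k ^ 2)
        ≤ (12 * (256 * (k ^ 3 * t)) + 2 * x) * (4 * k ^ 2) := by gcongr
      _ = 12288 * (k ^ 5 * t) + 8 * (k ^ 2 * x) := by ring
      _ ≤ 1 := by linarith
  · rw [he]
    calc (12 * r + 2 * x * (r ^ 2 + r)) * ((k : ℝ) ^ 2 * q)
        = 12 * k ^ 2 * (r * q) + 2 * x * k ^ 2 * (r ^ 2 * q) + 2 * x * k ^ 2 * (r * q) := by ring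
      _ ≤ 12 * k ^ 2 * (64 * (k * t)) + 2 * x * k ^ 2 * (32 * k ^ 2) +
          2 * 1 * k ^ 2 * (64 * (k * t)) := by gcongr
      _ = 896 * (k ^ 3 * t) + 64 * (k ^ 4 * x) := by ring
      _ ≤ 1 / 2 := by linarith
  · rw [mul_one_div, le_div_iff₀ h2k, hr]
    nlinarith

/-! ### Couplings of consecutive iterates and weak convergence -/

theorem isGood_map_iff {E F : Type*} [MeasurableSpace E] [MeasurableSpace F] {ν : Measure E}
    {k : ℕ} {g : E → F} {p : F → I} (hg : Measurable g) (hp : Measurable p) :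
    IsGood k (ν.map g) p ↔ IsGood k ν fun e => p (g e) := by
  have hm : Measurable fun e => odds (p e : ℝ) := measurable_odds.comp hp.subtype_val
  have hs : MeasurableSet {f : F | (p f : ℝ) < 1} := measurableSet_lt hp.subtype_val measurable_const
  have h1 : (∀ᵐ e ∂(ν.map g), (p e : ℝ) < 1) ↔ ∀ᵐ e ∂ν, (p (g e) : ℝ) < 1 :=
    ae_map_iff hg.aemeasurable hs
  have h2 : MemLp (fun e => odds (p e : ℝ)) 2 (ν.map g) ↔
      MemLp (fun e => odds (p (g e) : ℝ)) 2 ν :=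
    memLp_map_measure_iff hm.aestronglyMeasurable hg.aemeasurable
  have h3 : ∫ e, (odds (p e : ℝ) - 1) ^ 2 ∂(ν.map g) = ∫ e, (odds (p (g e) : ℝ) - 1) ^ 2 ∂ν :=
    integral_map hg.aemeasurable ((hm.sub_const 1).pow_const 2).aestronglyMeasurable
  exact ⟨fun h => ⟨hp.comp hg, h1.1 h.lt_one, h2.1 h.memLp, h3 ▸ h.dev⟩,
    fun h => ⟨hp, h1.2 h.lt_one, h2.2 h.memLp, h3 ▸ h.dev⟩⟩

/-- Reading i.i.d. entries through `p` gives i.i.d. entries of law `ν.map p`. With `p` a coordinate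
projection, this identifies the marginals of `coupledRec`. -/
theorem map_recThrough {E : Type*} [MeasurableSpace E] (k : ℕ) (r : ℝ≥0) (ν : Measure E)
    [IsProbabilityMeasure ν] {p : E → I} (hp : Measurable p) :
    (arrayLaw r ν).map (recThrough k p) = (arrayLaw r (ν.map p)).map (recMap k) := by
  have : IsProbabilityMeasure (ν.map p) := Measure.isProbabilityMeasure_map hp.aemeasurable
  have hpi : Measurable fun (η : Bool × ℕ × ℕ → E) x => p (η x) := by fun_prop
  have h : arrayLaw r (ν.map p) =
      (arrayLaw r ν).map (Prod.map id fun (η : Bool × ℕ × ℕ → E) x => p (η x)) := by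
    unfold arrayLaw
    rw [← Measure.map_prod_map _ _ measurable_id hpi, Measure.map_id,
      Measure.infinitePi_map_pi (fun _ : Bool × ℕ × ℕ => ν) fun _ => hp]
  rw [h, Measure.map_map (measurable_recMap k) (by fun_prop)]
  rfl

theorem coe_distRec (k : ℕ) (α : ℝ≥0) (μ : ProbabilityMeasure I) :
    (distRec k α μ : Measure I) = (arrayLaw (α * k / 2) (μ : Measure I)).map (recMap k) := by
  rw [distRec, ProbabilityMeasure.toMeasure_map]
  rfl

theorem isGood_distRec {k : ℕ} {α : ℝ≥0} (hb : NumericBounds k (α * k / 2 : ℝ≥0))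
    {μ : ProbabilityMeasure I} (h : IsGood k (μ : Measure I) id) :
    IsGood k (distRec k α μ : Measure I) id := by
  have e : recThrough k (id : I → I) = recMap k := rfl
  have h' := h.recThrough hb
  rw [e] at h'
  rw [coe_distRec]
  exact (isGood_map_iff (measurable_recMap k) measurable_id).2 h'

theorem isGood_iter {k : ℕ} {α : ℝ≥0} (hb : NumericBounds k (α * k / 2 : ℝ≥0)) (ℓ : ℕ) :
    IsGood k (iter k α ℓ : Measure I) id := by
  induction ℓ with
  | zero =>
    have hd : (iter k α 0 : Measure I) = Measure.dirac oneHalf := rfl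
    have ho : odds (oneHalf : ℝ) = 1 := by norm_num [odds, oneHalf]
    have hm : Measurable fun e : I => odds (e : ℝ) := measurable_odds.comp measurable_subtype_coe
    have hae : (fun e : I => odds (e : ℝ)) =ᵐ[Measure.dirac oneHalf] fun _ => 1 := by
      rw [Filter.EventuallyEq, ae_dirac_iff (measurableSet_eq_fun hm measurable_const)]
      exact ho
    rw [hd]
    refine ⟨measurable_id, ?_, (memLp_congr_ae hae).2 (memLp_const 1), ?_⟩
    · simp only [id]
      rw [ae_dirac_iff (measurableSet_lt measurable_subtype_coe measurable_const)]
      norm_num [oneHalf]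
    · have : ∫ e : I, (odds (e : ℝ) - 1) ^ 2 ∂(Measure.dirac oneHalf) = ∫ _e : I, (0 : ℝ)
          ∂(Measure.dirac oneHalf) :=
        integral_congr_ae (hae.mono fun e he => by dsimp only at he ⊢; rw [he]; norm_num)
      simp only [id]
      rw [this, integral_zero]
      positivity
  | succ ℓ ih => exact isGood_distRec hb ih

theorem IsGood.measure_one_eq_zero {k : ℕ} {μ : Measure I} (h : IsGood k μ id) : μ {1} = 0 := by
  have h1 := h.lt_one
  rw [ae_iff] at h1
  refine measure_mono_null (fun x hx => ?_) h1
  rw [Set.mem_singleton_iff.1 hx]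
  simp

/-- The image of a coupling under the recursion with common Poisson variables. -/
def coupledRec (k : ℕ) (r : ℝ≥0) (γ : Measure (I × I)) : Measure (I × I) :=
  (arrayLaw r γ).map fun ω => (recThrough k Prod.fst ω, recThrough k Prod.snd ω)

/-- The independent coupling starts the induction, its cost being at most `1` by the invariant; each
application of `coupledRec` halves the cost. -/
theorem exists_coupling {k : ℕ} {α : ℝ≥0} (hb : NumericBounds k (α * k / 2 : ℝ≥0)) (ℓ : ℕ) :
    ∃ γ : Measure (I × I), IsProbabilityMeasure γ ∧ γ.map Prod.fst = iter k α ℓ ∧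
      γ.map Prod.snd = iter k α (ℓ + 1) ∧
      ∫ e, (odds (e.1 : ℝ) - odds (e.2 : ℝ)) ^ 2 ∂γ ≤ (1 / 2) ^ ℓ := by
  induction ℓ with
  | zero =>
    have hf : ((iter k α 0 : Measure I).prod (iter k α 1 : Measure I)).map Prod.fst =
        iter k α 0 := by simp
    have hs : ((iter k α 0 : Measure I).prod (iter k α 1 : Measure I)).map Prod.snd =
        iter k α 1 := by simp
    refine ⟨_, inferInstance, hf, hs, ?_⟩
    have h0 := isGood_iter hb 0
    have h1 := isGood_iter hb 1
    rw [← hf, isGood_map_iff measurable_fst measurable_id] at h0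
    rw [← hs, isGood_map_iff measurable_snd measurable_id] at h1
    have := integral_add_sq_le h0.memLp_sub_one h1.memLp_sub_one.neg
    have hk : (2 : ℝ) ≤ k := by exact_mod_cast hb.two_le
    have hle : 1 / (4 * (k : ℝ) ^ 2) ≤ 1 / 4 := by
      rw [div_le_div_iff₀ (by positivity) (by norm_num)]; nlinarith
    have d0 := h0.dev
    have d1 := h1.dev
    simp only [Pi.neg_apply, neg_sq, id] at this d0 d1
    rw [pow_zero]
    refine le_trans (le_of_eq ?_) (this.trans (by linarith))
    congr 1
    funext e
    ring
  | succ ℓ ih =>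
    obtain ⟨γ, hγ, hf, hs, hD⟩ := ih
    have h0 := isGood_iter hb ℓ
    have h1 := isGood_iter hb (ℓ + 1)
    rw [← hf, isGood_map_iff measurable_fst measurable_id] at h0
    rw [← hs, isGood_map_iff measurable_snd measurable_id] at h1
    have m1 : Measurable (recThrough k (Prod.fst : I × I → I)) :=
      measurable_recThrough k measurable_fst
    have m2 : Measurable (recThrough k (Prod.snd : I × I → I)) :=
      measurable_recThrough k measurable_snd
    refine ⟨coupledRec k (α * k / 2) γ, Measure.isProbabilityMeasure_map
      (m1.prodMk m2).aemeasurable, ?_, ?_, ?_⟩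
    · rw [coupledRec, Measure.map_map measurable_fst (m1.prodMk m2)]
      exact (map_recThrough k _ γ measurable_fst).trans (by rw [hf]; rfl)
    · rw [coupledRec, Measure.map_map measurable_snd (m1.prodMk m2)]
      exact (map_recThrough k _ γ measurable_snd).trans (by rw [hs]; rfl)
    · have hm : Measurable fun e : I × I => (odds (e.1 : ℝ) - odds (e.2 : ℝ)) ^ 2 :=
        ((measurable_odds.comp measurable_fst.subtype_val).sub
          (measurable_odds.comp measurable_snd.subtype_val)).pow_const 2
      rw [coupledRec, integral_map (m1.prodMk m2).aemeasurable hm.aestronglyMeasurable, pow_succ]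
      have := h0.integral_recThrough_sub_sq_le hb h1
      simp only [id] at this hD
      refine this.trans ?_
      linarith

/-- The odds map expands distances, so the L² cost of the coupling controls the mean distance by
Cauchy-Schwarz. -/
theorem abs_integral_iter_sub_le {k : ℕ} {α : ℝ≥0} (hb : NumericBounds k (α * k / 2 : ℝ≥0))
    {f : I → ℝ} {L : ℝ≥0} (hf : LipschitzWith L f) (ℓ : ℕ) :
    |∫ x, f x ∂(iter k α ℓ : Measure I) - ∫ x, f x ∂(iter k α (ℓ + 1) : Measure I)| ≤
      L * √(1 / 2) ^ ℓ := by
  obtain ⟨γ, hγ, hfst, hsnd, hD⟩ := exists_coupling hb ℓ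
  have h0 := isGood_iter hb ℓ
  have h1 := isGood_iter hb (ℓ + 1)
  have hc := hf.continuous
  rw [← hfst, isGood_map_iff measurable_fst measurable_id] at h0
  rw [← hsnd, isGood_map_iff measurable_snd measurable_id] at h1
  rw [← hfst, ← hsnd, integral_map measurable_fst.aemeasurable hc.aestronglyMeasurable,
    integral_map measurable_snd.aemeasurable hc.aestronglyMeasurable]
  have hmD : MemLp (fun e : I × I => odds (e.1 : ℝ) - odds (e.2 : ℝ)) 2 γ := h0.memLp.sub h1.memLp
  have hmA : MemLp (fun e : I × I => |odds (e.1 : ℝ) - odds (e.2 : ℝ)|) 2 γ := hmD.abs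
  have iA := hmA.integrable one_le_two
  obtain ⟨C, hC⟩ := isCompact_univ.exists_bound_of_continuousOn hc.continuousOn
  have i1 : Integrable (fun e : I × I => f e.1) γ :=
    Integrable.of_bound (hc.comp continuous_fst).aestronglyMeasurable C
      (Eventually.of_forall fun e => hC _ (Set.mem_univ _))
  have i2 : Integrable (fun e : I × I => f e.2) γ :=
    Integrable.of_bound (hc.comp continuous_snd).aestronglyMeasurable C
      (Eventually.of_forall fun e => hC _ (Set.mem_univ _))
  have hCS := sq_integral_mul_le hmA (memLp_const (1 : ℝ))
  simp only [mul_one, sq_abs, one_pow, integral_const, probReal_univ, one_smul] at hCS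
  have hA0 : 0 ≤ ∫ e : I × I, |odds (e.1 : ℝ) - odds (e.2 : ℝ)| ∂γ :=
    integral_nonneg fun _ => abs_nonneg _
  have hA : ∫ e : I × I, |odds (e.1 : ℝ) - odds (e.2 : ℝ)| ∂γ ≤ √(1 / 2) ^ ℓ := by
    refine le_of_sq_le_sq ?_ (by positivity)
    rw [← pow_mul, mul_comm ℓ 2, pow_mul, Real.sq_sqrt (by norm_num)]
    exact hCS.trans hD
  rw [← integral_sub i1 i2]
  refine abs_integral_le_integral_abs.trans (le_trans ?_ (mul_le_mul_of_nonneg_left hA L.2))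
  rw [← NNReal.val_eq_coe, ← integral_const_mul]
  refine integral_mono_ae (i1.sub i2).abs (iA.const_mul _) ?_
  filter_upwards [h0.lt_one, h1.lt_one] with e he he'
  have := hf.dist_le_mul e.1 e.2
  rw [Real.dist_eq, Subtype.dist_eq, Real.dist_eq] at this
  exact this.trans (mul_le_mul_of_nonneg_left
    (abs_sub_le_abs_odds_sub e.1.2.1 he e.2.2.1 he') L.2)

/-- The iterates converge weakly. -/
theorem exists_tendsto_iter {k : ℕ} {α : ℝ≥0} (hb : NumericBounds k (α * k / 2 : ℝ≥0)) :
    ∃ μ : ProbabilityMeasure I, Tendsto (iter k α) atTop (𝓝 μ) := by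
  -- Compactness only provides a candidate limit; the Cauchy property below carries the convergence
  -- over from the subsequence to the whole sequence.
  obtain ⟨μ, φ, hφ, hμ⟩ := CompactSpace.tendsto_subseq (iter k α)
  refine ⟨μ, tendsto_iff_forall_lipschitz_integral_tendsto.2 ?_⟩
  rintro f hbd ⟨L, hL⟩
  have hcau : CauchySeq fun ℓ => ∫ x, f x ∂(iter k α ℓ : Measure I) :=
    cauchySeq_of_le_geometric (√(1 / 2)) L
      (by rw [Real.sqrt_lt' one_pos]; norm_num) fun ℓ => by
        rw [Real.dist_eq]; exact abs_integral_iter_sub_le hb hL ℓ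
  obtain ⟨c, hc⟩ := cauchySeq_tendsto_of_complete hcau
  have h1 := tendsto_iff_forall_lipschitz_integral_tendsto.1 hμ f hbd ⟨L, hL⟩
  have h2 := hc.comp hφ.tendsto_atTop
  rw [tendsto_nhds_unique h1 h2]
  exact hc

/-! ### Absence of an atom at `1` -/

/-- Markov's inequality for the squared odds. The event is written without division so that it is
open and contains `1`, where `odds` takes the default value `0`. -/
theorem IsGood.measure_large_odds_le {k N : ℕ} (hk : 1 ≤ k) (hN : N ≠ 0) {μ : Measure I}
    [IsProbabilityMeasure μ] (h : IsGood k μ id) :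
    μ {a : I | (N : ℝ) * (1 - a) < a} ≤ ENNReal.ofReal (4 / (N : ℝ) ^ 2) := by
  have hN0 : (0 : ℝ) < N := by exact_mod_cast Nat.pos_of_ne_zero hN
  have hM := mul_meas_ge_le_integral_of_nonneg
    (Eventually.of_forall fun e : I => sq_nonneg (odds (e : ℝ))) h.memLp.integrable_sq
    ((N : ℝ) ^ 2)
  have h4 := h.integral_odds_sq_le hk
  simp only [id] at h4 hM
  have hle : μ {a : I | (N : ℝ) * (1 - a) < a} ≤ μ {a : I | (N : ℝ) ^ 2 ≤ odds a ^ 2} := by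
    refine measure_mono_ae ?_
    filter_upwards [h.lt_one] with a ha hlt
    have ha' : 0 < 1 - (a : ℝ) := by simp only [id] at ha; linarith
    refine pow_le_pow_left₀ hN0.le ?_ 2
    rw [odds, le_div_iff₀ ha']
    exact le_of_lt hlt
  refine hle.trans ?_
  rw [← ENNReal.ofReal_toReal (measure_ne_top μ {a : I | (N : ℝ) ^ 2 ≤ odds a ^ 2})]
  refine ENNReal.ofReal_le_ofReal ?_
  rw [le_div_iff₀ (by positivity)]
  have e : (μ {a : I | (N : ℝ) ^ 2 ≤ odds a ^ 2}).toReal =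
    μ.real {a : I | (N : ℝ) ^ 2 ≤ odds a ^ 2} := rfl
  rw [e]
  linarith

/-- By the portmanteau theorem the uniform tail bound on these open neighbourhoods of `1` passes to
the limit; then `N → ∞`. -/
theorem measure_one_eq_zero_of_tendsto {k : ℕ} (hk : 1 ≤ k) {μs : ℕ → ProbabilityMeasure I}
    {μ : ProbabilityMeasure I} (hs : ∀ n, IsGood k (μs n : Measure I) id)
    (h : Tendsto μs atTop (𝓝 μ)) : (μ : Measure I) {1} = 0 := by
  have hN : ∀ N : ℕ, N ≠ 0 → (μ : Measure I) {1} ≤ ENNReal.ofReal (4 / (N : ℝ) ^ 2) := by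
    intro N hN
    have hopen : IsOpen {a : I | (N : ℝ) * (1 - a) < a} :=
      isOpen_lt (by fun_prop) (by fun_prop)
    calc (μ : Measure I) {1} ≤ (μ : Measure I) {a : I | (N : ℝ) * (1 - a) < a} :=
          measure_mono (by simp)
      _ ≤ atTop.liminf fun n => (μs n : Measure I) {a : I | (N : ℝ) * (1 - a) < a} :=
          ProbabilityMeasure.le_liminf_measure_open_of_tendsto h hopen
      _ ≤ _ := liminf_le_of_frequently_le' (Frequently.of_forall fun n =>
          (hs n).measure_large_odds_le hk hN)
  have ht : Tendsto (fun N : ℕ => ENNReal.ofReal (4 / (N : ℝ) ^ 2)) atTop (𝓝 0) := by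
    rw [← ENNReal.ofReal_zero]
    refine ENNReal.tendsto_ofReal (Tendsto.div_atTop tendsto_const_nhds ?_)
    exact (tendsto_pow_atTop two_ne_zero).comp tendsto_natCast_atTop_atTop
  refine le_antisymm (ge_of_tendsto ht ?_) zero_le
  filter_upwards [eventually_ne_atTop 0] with N h0 using hN N h0

/-! ### Weak continuity of the recursion -/

/-- The infinite product of copies of a probability measure. -/
def infPower (ι : Type*) (μ : ProbabilityMeasure I) : ProbabilityMeasure (ι → I) :=
  ⟨Measure.infinitePi fun _ : ι => (μ : Measure I), inferInstance⟩

/-- The measures on the compact cube form a compact space, and any subsequential limit has the right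
finite-dimensional marginals because finite products are continuous. -/
theorem continuous_infPower (ι : Type*) [Countable ι] : Continuous (infPower ι) := by
  rw [continuous_iff_seqContinuous]
  intro μs μ h
  refine tendsto_of_subseq_tendsto fun ns hns => ?_
  obtain ⟨ν, φ, hφ, hν⟩ := CompactSpace.tendsto_subseq fun n => infPower ι (μs (ns n))
  have heq : ν = infPower ι μ := by
    refine ProbabilityMeasure.toMeasure_injective ?_
    have hlim := Measure.isProjectiveLimit_infinitePi fun _ : ι => (μ : Measure I)
    refine IsProjectiveLimit.unique (fun J => ?_) hlim
    have hcont : Continuous (J.restrict : (ι → I) → (J → I)) := by fun_prop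
    have h1 := ProbabilityMeasure.tendsto_map_of_tendsto_of_continuous _ _ hν hcont
    have h2 : Tendsto (fun n => ProbabilityMeasure.pi fun _ : J => μs n) atTop
        (𝓝 (ProbabilityMeasure.pi fun _ : J => μ)) :=
      (ProbabilityMeasure.continuous_pi.tendsto _).comp (tendsto_pi_nhds.2 fun _ => h)
    have h3 := h2.comp (hns.comp hφ.tendsto_atTop)
    have e : ∀ μ' : ProbabilityMeasure I,
        (infPower ι μ').map hcont.measurable.aemeasurable = ProbabilityMeasure.pi fun _ : J => μ' :=
      fun μ' => ProbabilityMeasure.toMeasure_injective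
        (Measure.infinitePi_map_restrict fun _ : ι => (μ' : Measure I))
    simp only [Function.comp_def, e] at h1 h3
    have h4 := congrArg ProbabilityMeasure.toMeasure (tendsto_nhds_unique h1 h3)
    simpa using h4
  exact ⟨φ, heq ▸ hν⟩

theorem continuous_sampleLaw (k : ℕ) (α : ℝ≥0) : Continuous (sampleLaw k α) := by
  have h : sampleLaw k α = fun μ => ProbabilityMeasure.prod
      (ProbabilityMeasure.prod (⟨poissonMeasure (α * k / 2), inferInstance⟩ : ProbabilityMeasure ℕ)
        (⟨poissonMeasure (α * k / 2), inferInstance⟩ : ProbabilityMeasure ℕ))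
      (infPower (Bool × ℕ × ℕ) μ) := rfl
  rw [h]
  exact ProbabilityMeasure.continuous_prod.comp
    (continuous_const.prodMk (continuous_infPower (Bool × ℕ × ℕ)))

theorem continuous_clauseProd (k : ℕ) (s : Bool) (d : ℕ) : Continuous (clauseProd k s d) := by
  unfold clauseProd
  fun_prop

theorem continuous_piPlus (k : ℕ) : Continuous (piPlus k) :=
  continuous_prod_of_discrete_left.2 fun d => continuous_clauseProd k true d.1

theorem continuous_piMinus (k : ℕ) : Continuous (piMinus k) :=
  continuous_prod_of_discrete_left.2 fun d => continuous_clauseProd k false d.2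

/-- The event that `Π⁺` and `Π⁻` are both positive. -/
def regularSet (k : ℕ) : Set Sample := {ω | 0 < piPlus k ω ∧ 0 < piMinus k ω}

theorem isOpen_regularSet (k : ℕ) : IsOpen (regularSet k) :=
  (isOpen_lt continuous_const (continuous_piPlus k)).inter
    (isOpen_lt continuous_const (continuous_piMinus k))

theorem continuousOn_recMap (k : ℕ) : ContinuousOn (recMap k) (regularSet k) := by
  refine Topology.IsInducing.subtypeVal.continuousOn_iff.2 ?_
  have hP := (continuous_piPlus k).continuousOn (s := regularSet k)
  have hM := (continuous_piMinus k).continuousOn (s := regularSet k)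
  refine ((continuousOn_const.sub hM).mul hP).div ((hP.add hM).sub (hP.mul hM)) fun ω hω => ?_
  have h1 : piMinus k ω ≤ 1 := (clauseProd_mem k false ω.1.2 ω.2).2
  have h2 := hω.1
  have h3 := hω.2
  nlinarith

theorem ae_mem_regularSet {k : ℕ} (hk : 2 ≤ k) (α : ℝ≥0) {μ : ProbabilityMeasure I}
    (h : (μ : Measure I) {1} = 0) : ∀ᵐ ω ∂(sampleLaw k α μ : Measure Sample), ω ∈ regularSet k := by
  have h1 : ∀ᵐ e ∂(μ : Measure I), ((id e : I) : ℝ) < 1 := by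
    rw [ae_iff]
    refine measure_mono_null (fun x hx => ?_) h
    exact Subtype.ext (le_antisymm x.2.2 (not_lt.1 hx))
  filter_upwards [ae_array (α * k / 2) h1] with ω hω
  exact ⟨clauseProd_pos hk true ω.1.1 hω, clauseProd_pos hk false ω.1.2 hω⟩

/-- The recursion is weakly continuous at every measure without an atom at `1`. -/
theorem tendsto_distRec {k : ℕ} (hk : 2 ≤ k) (α : ℝ≥0) {μs : ℕ → ProbabilityMeasure I}
    {μ : ProbabilityMeasure I} (h1 : (μ : Measure I) {1} = 0) (h : Tendsto μs atTop (𝓝 μ)) :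
    Tendsto (fun n => distRec k α (μs n)) atTop (𝓝 (distRec k α μ)) := by
  refine tendsto_of_forall_isOpen_le_liminf' fun G hG => ?_
  -- `recMap k` is continuous only on the regular set, so the portmanteau theorem is applied to this
  -- smaller open set; under the limiting law nothing is lost.
  have hopen : IsOpen (regularSet k ∩ recMap k ⁻¹' G) :=
    (continuousOn_recMap k).isOpen_inter_preimage (isOpen_regularSet k) hG
  have e : ∀ μ' : ProbabilityMeasure I, (distRec k α μ' : Measure I) G =
      (sampleLaw k α μ' : Measure Sample) (recMap k ⁻¹' G) := fun μ' => by
    rw [distRec, ProbabilityMeasure.toMeasure_map,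
      Measure.map_apply (measurable_recMap k) hG.measurableSet]
  simp only [e]
  have h2 : (sampleLaw k α μ : Measure Sample) (recMap k ⁻¹' G) ≤
      (sampleLaw k α μ : Measure Sample) (regularSet k ∩ recMap k ⁻¹' G) := by
    refine measure_mono_ae ?_
    filter_upwards [ae_mem_regularSet hk α h1] with ω hω hG using ⟨hω, hG⟩
  refine h2.trans ((ProbabilityMeasure.le_liminf_measure_open_of_tendsto
    (((continuous_sampleLaw k α).tendsto μ).comp h) hopen).trans ?_)
  exact liminf_le_liminf (Eventually.of_forall fun n => measure_mono Set.inter_subset_right)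

end KSat

end

theorem proposition1 :
    ∃ k₀ : ℕ, ∀ k : ℕ, k₀ ≤ k → ∀ α : ℝ≥0,
      (2 : ℝ) ^ k * Real.log 2 - 2 ≤ (α : ℝ) → (α : ℝ) ≤ (2 : ℝ) ^ k * Real.log 2 →
        (∀ ℓ : ℕ, (KSat.iter k α ℓ : Measure I) {1} = 0) ∧
        ∃ μ : ProbabilityMeasure I,
          Tendsto (KSat.iter k α) atTop (𝓝 μ) ∧
          (μ : Measure I) {1} = 0 ∧
          KSat.distRec k α μ = μ := by
  obtain ⟨k₀, hk₀⟩ := eventually_atTop.1 KSat.eventually_numericBounds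
  refine ⟨k₀, fun k hk α h1 h2 => ?_⟩
  have hb := hk₀ k hk α h1 h2
  have hgood := KSat.isGood_iter hb
  obtain ⟨μ, hμ⟩ := KSat.exists_tendsto_iter hb
  have hμ1 := KSat.measure_one_eq_zero_of_tendsto (one_le_two.trans hb.two_le) hgood hμ
  refine ⟨fun ℓ => (hgood ℓ).measure_one_eq_zero, μ, hμ, hμ1, ?_⟩
  -- The shifted sequence of iterates is the recursion applied to the iterates, so it tends both to
  -- the image of `μ` and to `μ`.
  exact tendsto_nhds_unique (KSat.tendsto_distRec hb.two_le α hμ1 hμ)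
    ((tendsto_add_atTop_iff_nat 1).2 hμ)
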